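/- Let $k$ be a field and let $A=\bigoplus_{i\ge 0}A_i$ be a connected ($A_0=k$) $\mathbb Z_{\ge 0}$-graded associative $k$-algebra which is finitely presented. For a $\mathbb Z$-graded right $A$-module $M=\bigoplus_{j\in\mathbb Z}M_j$ and $i\ge 0$ put $$m_i(M)=\sup\{\,j\in\mathbb Z \mid \operatorname{Tor}_i^A(M,k)_j\neq 0\,\}\in\mathbb Z\cup\{\pm\infty\}\qquad(\sup\emptyset=-\infty),$$ where $\operatorname{Tor}_i^A(M,k)_j$ is the component of degree $j$ of the graded vector space $\operatorname{Tor}_i^A(M,k)$. Given five integers $m,p_1,p_2,q,r$, let $DM_A=DM_A(m,p_1,p_2,q,r)$ be the set of all finitely presented graded right $A$-modules $M$ with at most $m$ generators such that $M_i=0$ for $i<p_1$, $m_0(M)\le p_2$, $m_1(M)\le q$ and $m_2(M)\le r$. Then every $M\in DM_A$ has finite-dimensional homogeneous components, and the set of Hilbert series $$\Bigl\{\,\sum_{j\in\mathbb Z}(\dim_k M_j)\,z^j \;\Bigm|\; M\in DM_A\,\Bigr\}$$ is finite. -/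

import Mathlib

open scoped TensorProduct

universe u v

/-- The graded algebra `A` is connected: `A₀` is the base field `k`. -/
def IsConnectedGraded {k : Type u} [Field k] {A : Type v} [Ring A] [Algebra k A]
    (𝒜 : ℕ → Submodule k A) : Prop :=
  Nontrivial A ∧ ∀ a ∈ 𝒜 0, ∃ c : k, a = algebraMap k A c

/-- The (noncommutative) `k`-algebra `A` is finitely presented: it is the quotient of a free
associative algebra on finitely many generators by a two-sided ideal generated by a finite set. -/
def IsFinitelyPresentedAlgebra (k : Type u) [Field k] (A : Type v) [Ring A] [Algebra k A] :
    Prop :=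
  ∃ (n : ℕ) (φ : FreeAlgebra k (Fin n) →ₐ[k] A) (S : Set (FreeAlgebra k (Fin n))),
    Function.Surjective φ ∧ S.Finite ∧ TwoSidedIdeal.ker φ = TwoSidedIdeal.span S

/-- A `ℤ`-graded right module over the graded `k`-algebra `A = ⨁ 𝒜 i`. A right `A`-module is a
module over `Aᵐᵒᵖ`; the product `m a` is `MulOpposite.op a • m`. -/
structure GradedRightModule {k : Type u} [Field k] {A : Type v} [Ring A] [Algebra k A]
    (𝒜 : ℕ → Submodule k A) where
  carrier : Type v
  [addCommGroup : AddCommGroup carrier]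
  [module : Module k carrier]
  [rightModule : Module Aᵐᵒᵖ carrier]
  [isScalarTower : IsScalarTower k Aᵐᵒᵖ carrier]
  /-- The homogeneous components. -/
  deg : ℤ → Submodule k carrier
  isInternal : DirectSum.IsInternal deg
  smul_mem : ∀ (i : ℕ) (j : ℤ) (a : A) (x : carrier), a ∈ 𝒜 i → x ∈ deg j →
    MulOpposite.op a • x ∈ deg (j + i)

attribute [instance] GradedRightModule.addCommGroup GradedRightModule.module
  GradedRightModule.rightModule GradedRightModule.isScalarTower

section Augmentation

variable {k : Type u} [Field k] {A : Type v} [Ring A] [Algebra k A]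
  (𝒜 : ℕ → Submodule k A) [GradedAlgebra 𝒜]

/-- The augmentation ideal `A₊ = A₁ ⊕ A₂ ⊕ ⋯`, the elements with zero component in degree `0`. -/
def augIdeal : Submodule k A := LinearMap.ker (GradedAlgebra.proj 𝒜 0)

theorem mul_mem_augIdeal {a b : A} (ha : a ∈ augIdeal 𝒜) (_ : b ∈ augIdeal 𝒜) :
    a * b ∈ augIdeal 𝒜 := by
  have ha' : GradedRing.projZeroRingHom 𝒜 a = 0 := ha
  have h : GradedRing.projZeroRingHom 𝒜 (a * b) = 0 := by rw [map_mul, ha', zero_mul]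
  exact h

/-- The multiplication `A₊ ⊗ A₊ → A₊`. -/
noncomputable def augMul : (augIdeal 𝒜 ⊗[k] augIdeal 𝒜) →ₗ[k] augIdeal 𝒜 :=
  TensorProduct.lift (LinearMap.mk₂ k
    (fun a b => (⟨a.1 * b.1, mul_mem_augIdeal 𝒜 a.2 b.2⟩ : augIdeal 𝒜))
    (fun _ _ _ => Subtype.ext (add_mul _ _ _))
    (fun _ _ _ => Subtype.ext (smul_mul_assoc _ _ _))
    (fun _ _ _ => Subtype.ext (mul_add _ _ _))
    (fun _ _ _ => Subtype.ext (mul_smul_comm _ _ _)))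

end Augmentation

namespace GradedRightModule

variable {k : Type u} [Field k] {A : Type v} [Ring A] [Algebra k A]
  {𝒜 : ℕ → Submodule k A}

/-- Every homogeneous component is finite-dimensional. -/
def IsLocallyFinite (M : GradedRightModule 𝒜) : Prop :=
  ∀ j : ℤ, Module.Finite k (M.deg j)

/-- The Hilbert series `∑ (dim M_j) z^j`, as the formal series with coefficients `dim M_j`. -/
noncomputable def hilbertSeries (M : GradedRightModule 𝒜) : ℤ → ℕ :=
  fun j => Module.finrank k (M.deg j)

variable [GradedAlgebra 𝒜] (M : GradedRightModule 𝒜)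

/-- The multiplication `M ⊗ A₊ → M`, `m ⊗ a ↦ m a`. -/
noncomputable def augAct : (M.carrier ⊗[k] augIdeal 𝒜) →ₗ[k] M.carrier :=
  TensorProduct.lift (LinearMap.mk₂ k
    (fun x a => MulOpposite.op a.1 • x)
    (fun _ _ _ => smul_add _ _ _)
    (fun c x a => smul_comm (MulOpposite.op a.1) c x)
    (fun x a b => add_smul (MulOpposite.op a.1) (MulOpposite.op b.1) x)
    (fun c x a => smul_assoc c (MulOpposite.op a.1) x))

/-! ### The normalized bar complex `M ⊗ A₊^{⊗ n}`, whose homology is `Tor^A(M, k)` -/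

/-- The space `M ⊗ A₊^{⊗ n}`, tensor products over `k` being bracketed to the left. -/
noncomputable def barObj : ℕ → ModuleCat.{v} k
  | 0 => ModuleCat.of k M.carrier
  | n + 1 => ModuleCat.of k (barObj n ⊗[k] augIdeal 𝒜)

/-- The identification `(M ⊗ A₊^{⊗ n}) ⊗ A₊ = M ⊗ A₊^{⊗ (n + 1)}` (the identity map). -/
noncomputable def barSucc (n : ℕ) : (M.barObj n ⊗[k] augIdeal 𝒜) ≃ₗ[k] M.barObj (n + 1) :=
  LinearEquiv.refl k (M.barObj n ⊗[k] augIdeal 𝒜)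

/-- Multiplication of the last tensor factor from the right by an element of `A₊`:
`(m ⊗ a₁ ⊗ ⋯ ⊗ aₙ) ⊗ a ↦ m ⊗ a₁ ⊗ ⋯ ⊗ aₙ a` (and `m ⊗ a ↦ m a` for `n = 0`). -/
noncomputable def barAct : ∀ n : ℕ, (M.barObj n ⊗[k] augIdeal 𝒜) →ₗ[k] M.barObj n
  | 0 => M.augAct
  | n + 1 => (M.barSucc n).toLinearMap ∘ₗ
      LinearMap.lTensor (M.barObj n) (augMul 𝒜) ∘ₗ
      (TensorProduct.assoc k (M.barObj n) (augIdeal 𝒜) (augIdeal 𝒜)).toLinearMap ∘ₗ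
      LinearMap.rTensor (augIdeal 𝒜) (M.barSucc n).symm.toLinearMap

/-- The bar differential `M ⊗ A₊^{⊗ (n + 1)} → M ⊗ A₊^{⊗ n}`,
`m ⊗ a₁ ⊗ ⋯ ⊗ aₙ₊₁ ↦ m a₁ ⊗ a₂ ⊗ ⋯ + ∑ᵢ (-1)^i m ⊗ a₁ ⊗ ⋯ ⊗ aᵢ aᵢ₊₁ ⊗ ⋯ ⊗ aₙ₊₁`, for `1 ≤ i ≤ n`,
written recursively as `d (t ⊗ a) = d t ⊗ a + (-1)^n t a` for `t` in `M ⊗ A₊^{⊗ n}`, `n ≥ 1`. -/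
noncomputable def barD : ∀ n : ℕ, M.barObj (n + 1) →ₗ[k] M.barObj n
  | 0 => M.barAct 0 ∘ₗ (M.barSucc 0).symm.toLinearMap
  | n + 1 =>
    ((M.barSucc n).toLinearMap ∘ₗ LinearMap.rTensor (augIdeal 𝒜) (barD n) +
      (-1 : k) ^ (n + 1) • M.barAct (n + 1)) ∘ₗ (M.barSucc (n + 1)).symm.toLinearMap

theorem barD_zero (t : M.barObj 0) (a : augIdeal 𝒜) :
  M.barD 0 (M.barSucc 0 (t ⊗ₜ[k] a)) = M.barAct 0 (t ⊗ₜ a) := by simp [barD]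

theorem barD_succ (n : ℕ) (t : M.barObj (n+1)) (a : augIdeal 𝒜) :
  M.barD (n+1) (M.barSucc (n+1) (t ⊗ₜ[k] a)) = M.barSucc n ((M.barD n t) ⊗ₜ[k] a) +
    (-1 : k)^(n+1) • M.barAct (n+1) (t ⊗ₜ a) := by simp [barD]

theorem barAct_succ (n : ℕ) (s : M.barObj n) (b a : augIdeal 𝒜) :
  M.barAct (n+1) (M.barSucc n (s ⊗ₜ[k] b) ⊗ₜ[k] a) =
   M.barSucc n (s ⊗ₜ[k] (augMul 𝒜 (b ⊗ₜ a))) := by simp [barAct]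

theorem barObj_ind {n : ℕ} {P : M.barObj (n + 1) → Prop} (h0 : P 0)
    (h1 : ∀ s b, P (M.barSucc n (s ⊗ₜ b))) (h2 : ∀ x y, P x → P y → P (x + y))
    (t : M.barObj (n + 1)) : P t := by
  obtain ⟨t, rfl⟩ := (M.barSucc n).surjective t
  induction t using TensorProduct.induction_on with
  | zero => simpa using h0
  | tmul s c => exact h1 s c
  | add x y hx hy => rw [map_add]; exact h2 _ _ hx hy

theorem barAct_barAct (n : ℕ) : ∀ (t : M.barObj n) (b a : augIdeal 𝒜),
   M.barAct n (M.barAct n (t ⊗ₜ b) ⊗ₜ a) = M.barAct n (t ⊗ₜ (augMul 𝒜 (b ⊗ₜ a))) := by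
  cases n with
  | zero =>
    intro t b a
    change MulOpposite.op a.1 • MulOpposite.op b.1 • (show M.carrier from t) = MulOpposite.op (b.1*a.1) • (show M.carrier from t)
    rw [smul_smul, MulOpposite.op_mul]
  | succ n =>
    intro t b a
    induction t using M.barObj_ind with
    | h0 => simp
    | h1 s c =>
       rw [barAct_succ, barAct_succ, barAct_succ]
       have h : augMul 𝒜 (augMul 𝒜 (c ⊗ₜ b) ⊗ₜ a) = augMul 𝒜 (c ⊗ₜ augMul 𝒜 (b ⊗ₜ a)) :=
         Subtype.ext (mul_assoc c.1 b.1 a.1)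
       rw [h]
    | h2 x y hx hy =>
       simp only [TensorProduct.add_tmul, map_add, hx, hy]

theorem barD_barAct (n : ℕ) (t : M.barObj (n+1)) (a : augIdeal 𝒜) :
   M.barD n (M.barAct (n+1) (t ⊗ₜ a)) = M.barAct n (M.barD n t ⊗ₜ a) := by
  induction t using M.barObj_ind with
  | h0 => simp
  | h1 s b =>
    rw [barAct_succ]
    cases n with
    | zero => rw [barD_zero, barD_zero, barAct_barAct]
    | succ n =>
      rw [barD_succ, barD_succ, TensorProduct.add_tmul, map_add, ← TensorProduct.smul_tmul', map_smul, barAct_barAct, barAct_succ]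
  | h2 x y hx hy => simp only [TensorProduct.add_tmul, map_add, hx, hy]

/-- The bar complex is a complex. -/
theorem barD_barD (n : ℕ) (t : M.barObj (n + 1 + 1)) : M.barD n (M.barD (n+1) t) = 0 := by
  induction n with
  | zero =>
    induction t using M.barObj_ind with
    | h0 => simp
    | h1 t a => rw [barD_succ, map_add, map_smul, barD_barAct, barD_zero]; simp
    | h2 x y hx hy => simp only [map_add, hx, hy, add_zero]
  | succ n ih =>
    induction t using M.barObj_ind with
    | h0 => simp
    | h1 t a => rw [barD_succ, map_add, map_smul, barD_barAct, barD_succ, ih, pow_succ _ (n + 1)]; simp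
    | h2 x y hx hy => simp only [map_add, hx, hy, add_zero]

/-- The component of internal degree `j` of `M ⊗ A₊^{⊗ n}`: the span of the `m ⊗ a₁ ⊗ ⋯ ⊗ aₙ` with
homogeneous factors of total degree `j`. -/
noncomputable def barDeg : ∀ (n : ℕ) (_ : ℤ), Submodule k (M.barObj n)
  | 0, j => M.deg j
  | n + 1, j => ⨆ i : ℕ,
      (Submodule.map₂ (TensorProduct.mk k (M.barObj n) (augIdeal 𝒜))
        (barDeg n (j - i)) ((𝒜 i).comap (augIdeal 𝒜).subtype)).map (M.barSucc n).toLinearMap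

/-- The cycles of the bar complex. -/
noncomputable def barCycles : ∀ n : ℕ, Submodule k (M.barObj n)
  | 0 => ⊤
  | n + 1 => LinearMap.ker (M.barD n)

/-- The boundaries, as a subspace of the cycles. -/
noncomputable def barBoundaries (n : ℕ) : Submodule k (M.barCycles n) :=
  (LinearMap.range (M.barD n)).comap (M.barCycles n).subtype

/-- The vector space `Tor_n^A(M, k)`. -/
abbrev Tor (n : ℕ) : Type v := M.barCycles n ⧸ M.barBoundaries n

/-- The component `Tor_n^A(M, k)_j` of internal degree `j`. -/
noncomputable def torDeg (n : ℕ) (j : ℤ) : Submodule k (M.Tor n) :=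
  ((M.barDeg n j).comap (M.barCycles n).subtype).map (M.barBoundaries n).mkQ

/-- `m_n(M) = sup {j | Tor_n^A(M, k)_j ≠ 0}`, an integer or `±∞` (and `-∞` if the set is empty). -/
noncomputable def maxDeg (n : ℕ) : WithBot (WithTop ℤ) :=
  sSup {d | ∃ j : ℤ, d = ((j : WithTop ℤ) : WithBot (WithTop ℤ)) ∧ M.torDeg n j ≠ ⊥}

/-- `M` is generated by at most `m` elements as a right `A`-module. -/
def IsGeneratedByAtMost (m : ℤ) : Prop :=
  ∃ s : Finset M.carrier, (s.card : ℤ) ≤ m ∧ Submodule.span Aᵐᵒᵖ (s : Set M.carrier) = ⊤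

variable (𝒜)

/-- The set `DM_A(m, p₁, p₂, q, r)` of finitely presented graded right `A`-modules `M` with at most
`m` generators, `M_i = 0` for `i < p₁`, and `m₀(M) ≤ p₂`, `m₁(M) ≤ q`, `m₂(M) ≤ r`. -/
def boundedModules (m p₁ p₂ q r : ℤ) : Set (GradedRightModule 𝒜) :=
  {M | Module.FinitePresentation Aᵐᵒᵖ M.carrier ∧
    M.IsGeneratedByAtMost m ∧
    (∀ i : ℤ, i < p₁ → M.deg i = ⊥) ∧
    M.maxDeg 0 ≤ ((p₂ : WithTop ℤ) : WithBot (WithTop ℤ)) ∧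
    M.maxDeg 1 ≤ ((q : WithTop ℤ) : WithBot (WithTop ℤ)) ∧
    M.maxDeg 2 ≤ ((r : WithTop ℤ) : WithBot (WithTop ℤ))}

end GradedRightModule

/-! ### Ranks in algebraic families of complexes. -/

section RankFamilies

open Topology TopologicalSpace Module

/-! The bounds on `m₀`, `m₁`, `m₂` force every module in the class to have a presentation F₂ → F₁ →
F₀ → M → 0 by free modules whose numbers and degrees of generators do not depend on M. Indeed Tor₀
controls generators, Tor₁ relations and Tor₂ relations between relations. Below the relevant bound
one takes spanning sets of the homogeneous components, whose dimensions are bounded uniformly; above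
it, vanishing of Tor together with the graded Nakayama lemma `IsGrading.inf_le_map_genMap` shows
that nothing new is needed. The vanishing is given for the bar complex and is transferred to
syzygies by a diagram chase. The outcome is `GradedRightModule.hasResolution_of_mem_boundedModules`.

The pairs of matrices (F₁ → F₀, F₂ → F₁) lie in one finite-dimensional space, with its Zariski
topology. In each degree n both ranks can only jump up near a given point. Among pairs with zero
composite the sum of the two ranks in degree n is at most dim (F₁)ₙ, with equality when the complex
is exact at F₁; so near an exact point both ranks are constant (`finite_ranks_of_exact`). Two exact
points in one irreducible component have meeting neighbourhoods, hence the same ranks in every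
degree. A noetherian space has finitely many components, so finitely many rank functions occur, and
dim Mₙ is dim (F₀)ₙ minus the rank of F₁ → F₀ in degree n. -/

theorem finite_image_of_locally_constant {X α β : Type*} [TopologicalSpace X] [NoetherianSpace X]
    (H : X → α → β) (g : Set X) (h : ∀ x ∈ g, ∀ n, ∀ᶠ z in 𝓝 x, H z n = H x n) :
    (H '' g).Finite := by
  refine (Set.Finite.biUnion (NoetherianSpace.finite_irreducibleComponents (α := X))
    (t := fun Z => H '' (g ∩ Z)) fun Z hZ => Set.Subsingleton.finite ?_).subset ?_
  · rintro _ ⟨x, ⟨hx, hxZ⟩, rfl⟩ _ ⟨y, ⟨hy, hyZ⟩, rfl⟩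
    funext n
    obtain ⟨U, hU, hUo, hxU⟩ := eventually_nhds_iff.1 (h x hx n)
    obtain ⟨V, hV, hVo, hyV⟩ := eventually_nhds_iff.1 (h y hy n)
    -- `U` and `V` depend on `n`, and infinitely many of them could have no common point; but `z`
    -- may also depend on `n` and need not lie in `g`, so irreducibility suffices one `n` at a time.
    obtain ⟨z, -, hzU, hzV⟩ := hZ.1.2 U V hUo hVo ⟨x, hxZ, hxU⟩ ⟨y, hyZ, hyV⟩
    exact (hU z hzU).symm.trans (hV z hzV)
  · rintro _ ⟨x, hx, rfl⟩
    exact Set.mem_biUnion (irreducibleComponent_mem_irreducibleComponents x)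
      ⟨x, ⟨hx, mem_irreducibleComponent⟩, rfl⟩

variable {k : Type*} [Field k] {E V W Y : Type*} [AddCommGroup E] [Module k E]
  [AddCommGroup V] [Module k V] [AddCommGroup W] [Module k W] [AddCommGroup Y] [Module k Y]

/-- The Zariski topology on the points of a finite-dimensional space. -/
theorem exists_noetherian_topology [FiniteDimensional k E] :
    ∃ _ : TopologicalSpace E, NoetherianSpace E ∧
      ∀ (n : ℕ) (B : Matrix (Fin n) (Fin n) (Dual k E)),
        IsOpen {z : E | (Matrix.of fun i j => B i j z).det ≠ 0} := by
  let b := finBasis k E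
  -- A point goes to the prime ideal of polynomials vanishing at it. Pulling back the topology of
  -- the spectrum makes the space noetherian over any field, finite or not.
  let ev : E → PrimeSpectrum (MvPolynomial (Fin (finrank k E)) k) := fun z =>
    ⟨RingHom.ker (MvPolynomial.eval (b.repr z)), RingHom.ker_isPrime _⟩
  let _ : TopologicalSpace E := TopologicalSpace.induced ev inferInstance
  have hi : IsInducing ev := ⟨rfl⟩
  refine ⟨_, hi.noetherianSpace, fun n B => ?_⟩
  let P : Matrix (Fin n) (Fin n) (MvPolynomial (Fin (finrank k E)) k) :=
    Matrix.of fun i j => ∑ t, MvPolynomial.C (B i j (b t)) * MvPolynomial.X t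
  refine hi.isOpen_iff.2 ⟨_, PrimeSpectrum.isOpen_basicOpen (a := P.det), ?_⟩
  ext z
  have hP : (Matrix.of fun i j => B i j z) = (MvPolynomial.eval (b.repr z)).mapMatrix P := by
    ext i j
    refine (congrArg (B i j) (b.sum_repr z).symm).trans ?_
    rw [map_sum]
    simp [P, mul_comm]
  simp only [Set.mem_preimage, SetLike.mem_coe, PrimeSpectrum.mem_basicOpen, Set.mem_ofPred_eq, hP,
    ← RingHom.map_det]
  rfl

/-- A minor of full size that is nonzero at `x` stays nonzero on a neighbourhood. Only `G` is
finite-dimensional, so the minor is cut out by choosing vectors in `G` and functionals on `W`. -/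
theorem eventually_finrank_map_le [TopologicalSpace E]
    (hE : ∀ (n : ℕ) (B : Matrix (Fin n) (Fin n) (Dual k E)),
        IsOpen {z : E | (Matrix.of fun i j => B i j z).det ≠ 0})
    (T : E →ₗ[k] V →ₗ[k] W) (G : Submodule k V) [FiniteDimensional k G] (x : E) :
    ∀ᶠ z in 𝓝 x, finrank k (G.map (T x)) ≤ finrank k (G.map (T z)) := by
  let c := finBasis k (G.map (T x))
  choose v hvG hv using fun i => (c i).2
  -- Coordinates on the image at `x`, extended to all of `W`; with them the minor at `x` is the
  -- identity matrix.
  obtain ⟨φ, hφ⟩ : ∃ φ : W →ₗ[k] (Fin (finrank k (G.map (T x))) → k),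
      ∀ i, φ (T x (v i)) = Pi.single i 1 := by
    obtain ⟨f, hf⟩ := (c.equivFun.toLinearMap).exists_extend
    refine ⟨f, fun i => ?_⟩
    rw [hv]
    refine (LinearMap.congr_fun hf (c i)).trans ?_
    ext j
    simp [Pi.single_apply, eq_comm]
  let B : Matrix (Fin (finrank k (G.map (T x)))) (Fin (finrank k (G.map (T x)))) (Dual k E) :=
    Matrix.of fun i j => LinearMap.proj j ∘ₗ φ ∘ₗ T.flip (v i)
  refine Filter.mem_of_superset ((hE _ B).mem_nhds ?_) fun z hz => ?_
  · have : (Matrix.of fun i j => B i j x) = 1 := by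
      ext i j
      simp [B, hφ, Matrix.one_apply, Pi.single_apply, eq_comm]
    simp [this]
  · have hrow : LinearIndependent k (fun i => φ (T z (v i))) :=
      Matrix.linearIndependent_rows_of_det_ne_zero (A := Matrix.of fun i j => B i j z) hz
    have hlz : LinearIndependent k (fun i => T z (v i)) := LinearIndependent.of_comp φ hrow
    have hlz' : LinearIndependent k
        (fun i => (⟨T z (v i), Submodule.mem_map_of_mem (hvG i)⟩ : G.map (T z))) :=
      LinearIndependent.of_comp (G.map (T z)).subtype hlz
    simpa using hlz'.fintype_card_le_finrank

theorem Submodule.finrank_map_add_finrank_inf_ker (f : V →ₗ[k] W) (G : Submodule k V)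
    [FiniteDimensional k G] :
    finrank k (G.map f) + finrank k (G ⊓ LinearMap.ker f : Submodule k V) = finrank k G := by
  rw [← LinearMap.finrank_range_add_finrank_ker (f.domRestrict G), LinearMap.range_domRestrict,
    LinearMap.ker_domRestrict, ← Submodule.map_comap_subtype,
    Submodule.finrank_map_subtype_eq]

/-- In an algebraic family of complexes, the ranks are locally constant where the complex is
exact, hence take finitely many values there. -/
theorem finite_ranks_of_exact [FiniteDimensional k E] {ν : Type*} (T : E →ₗ[k] V →ₗ[k] W)
    (T' : E →ₗ[k] Y →ₗ[k] V) (G : ν → Submodule k V) (H : ν → Submodule k Y)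
    [∀ n, FiniteDimensional k (G n)] [∀ n, FiniteDimensional k (H n)] (X : Set E)
    (hX : ∀ z ∈ X, ∀ n, (H n).map (T' z) ≤ G n ⊓ LinearMap.ker (T z)) :
    ((fun z n => finrank k ((G n).map (T z))) ''
      {z ∈ X | ∀ n, (H n).map (T' z) = G n ⊓ LinearMap.ker (T z)}).Finite := by
  obtain ⟨τ, hN, hE⟩ := exists_noetherian_topology (k := k) (E := E)
  have hNX : NoetherianSpace X := IsInducing.subtypeVal.noetherianSpace
  refine (finite_image_of_locally_constant
    (fun (z : X) n => finrank k ((G n).map (T z)))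
    {z : X | ∀ n, (H n).map (T' z) = G n ⊓ LinearMap.ker (T z)} ?_).subset ?_
  · intro x hx n
    have h1 := (continuous_subtype_val (p := (· ∈ X))).continuousAt.eventually
      (eventually_finrank_map_le hE T (G n) (x : E))
    have h2 := (continuous_subtype_val (p := (· ∈ X))).continuousAt.eventually
      (eventually_finrank_map_le hE T' (H n) (x : E))
    -- Neither rank drops at `z`. Their sum is dim `G n` at `x` by exactness, and at most that at
    -- `z` because `z` still lies in `X`; hence both ranks are unchanged.
    filter_upwards [h1, h2] with z hz1 hz2
    have e1 := Submodule.finrank_map_add_finrank_inf_ker (T x) (G n)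
    have e2 := Submodule.finrank_map_add_finrank_inf_ker (T z) (G n)
    have : FiniteDimensional k (G n ⊓ LinearMap.ker (T z) : Submodule k V) :=
      Submodule.finiteDimensional_inf_left _ _
    have e3 := Submodule.finrank_mono (hX z z.2 n)
    have e4 : finrank k ((H n).map (T' x)) =
        finrank k (G n ⊓ LinearMap.ker (T x) : Submodule k V) := by rw [hx n]
    omega
  · rintro _ ⟨z, ⟨hz, hz'⟩, rfl⟩
    exact ⟨⟨z, hz⟩, hz', rfl⟩

end RankFamilies

/-! ### Gradings, free graded modules, the graded Nakayama lemma and dimension bounds. -/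

section Gradings

open Module MulOpposite

variable {k : Type*} [Field k]

/-- The subspaces `deg j` form a grading, expressed by means of the projections. -/
structure IsGrading {N : Type*} [AddCommGroup N] [Module k N] (deg : ℤ → Submodule k N) :
    Prop where
  iSup_eq_top : ⨆ j, deg j = ⊤
  exists_proj : ∃ p : ℤ → N →ₗ[k] N, ∀ n m x, x ∈ deg m → p n x = if m = n then x else 0

theorem DirectSum.IsInternal.isGrading {N : Type*} [AddCommGroup N] [Module k N]
    {deg : ℤ → Submodule k N} (h : DirectSum.IsInternal deg) : IsGrading deg := by
  classical
  refine ⟨h.submodule_iSup_eq_top, ?_⟩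
  let e := LinearEquiv.ofBijective (DirectSum.coeLinearMap deg) h
  refine ⟨fun n => (deg n).subtype ∘ₗ DirectSum.component k ℤ (fun j => deg j) n ∘ₗ
    e.symm.toLinearMap, fun n m x hx => ?_⟩
  have : e.symm x = DirectSum.lof k ℤ (fun j => deg j) m ⟨x, hx⟩ := by
    rw [LinearEquiv.symm_apply_eq]
    exact (DirectSum.coeLinearMap_lof deg m ⟨x, hx⟩).symm
  simp only [LinearMap.comp_apply, LinearEquiv.coe_coe, this]
  split_ifs with hmn
  · subst hmn
    rw [DirectSum.component.lof_self]
    rfl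
  · rw [DirectSum.component.of, dif_neg hmn]
    rfl

/-- The kernel of a homogeneous map is a homogeneous subspace. -/
theorem IsGrading.ker_le {N N' : Type*} [AddCommGroup N] [Module k N] [AddCommGroup N']
    [Module k N'] {deg : ℤ → Submodule k N} {deg' : ℤ → Submodule k N'} (h : IsGrading deg)
    (h' : IsGrading deg') (f : N →ₗ[k] N') (hf : ∀ j, ∀ x ∈ deg j, f x ∈ deg' j) :
    LinearMap.ker f ≤ ⨆ j, LinearMap.ker f ⊓ deg j := by
  intro x hx
  obtain ⟨g, hg, rfl⟩ := (Submodule.mem_iSup_iff_exists_finsupp _ x).1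
    (h.iSup_eq_top ▸ Submodule.mem_top : x ∈ ⨆ j, deg j)
  obtain ⟨p, hp⟩ := h'.exists_proj
  refine Submodule.sum_mem _ fun j _ => Submodule.mem_iSup_of_mem j ⟨?_, hg j⟩
  have h0 := congrArg (p j) (LinearMap.mem_ker.1 hx)
  rw [Finsupp.sum, map_sum, map_sum, map_zero] at h0
  rw [SetLike.mem_coe, LinearMap.mem_ker, ← h0]
  by_cases hj : j ∈ g.support
  · rw [Finset.sum_eq_single j (fun i _ hij => by rw [hp j i _ (hf i _ (hg i)), if_neg hij])
      (fun h => absurd hj h), hp j j _ (hf j _ (hg j)), if_pos rfl]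
  · rw [Finset.sum_eq_zero fun i hi => by
      rw [hp j i _ (hf i _ (hg i)), if_neg]; rintro rfl; exact hj hi]
    simp [Finsupp.notMem_support_iff.1 hj]

variable {A : Type*} [Ring A] [Algebra k A] (𝒜 : ℕ → Submodule k A)

/-- The grading of `A` extended by zero to negative degrees. -/
def intDeg (j : ℤ) : Submodule k A := if 0 ≤ j then 𝒜 j.toNat else ⊥

theorem intDeg_natCast (n : ℕ) : intDeg 𝒜 n = 𝒜 n := by simp [intDeg]

theorem intDeg_of_neg {j : ℤ} (h : j < 0) : intDeg 𝒜 j = ⊥ := by simp [intDeg, h]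

instance [∀ n, FiniteDimensional k (𝒜 n)] (j : ℤ) : FiniteDimensional k (intDeg 𝒜 j) := by
  rcases lt_or_ge j 0 with hj | hj
  · rw [intDeg_of_neg 𝒜 hj]
    infer_instance
  · lift j to ℕ using hj
    rw [intDeg_natCast]
    infer_instance

/-- The component of degree `n` of the free right module on generators of degrees `d i`. -/
def freeDeg {ι : Type*} (d : ι → ℤ) (n : ℤ) : Submodule k (ι → A) :=
  Submodule.pi Set.univ fun i => intDeg 𝒜 (n - d i)

theorem mem_freeDeg {ι : Type*} {d : ι → ℤ} {n : ℤ} {f : ι → A} :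
    f ∈ freeDeg 𝒜 d n ↔ ∀ i, f i ∈ intDeg 𝒜 (n - d i) := by
  simp [freeDeg, Submodule.mem_pi]

theorem Submodule.finiteDimensional_pi {ι : Type*} [Finite ι] {V : ι → Type*}
    [∀ i, AddCommGroup (V i)] [∀ i, Module k (V i)] (S : ∀ i, Submodule k (V i))
    [∀ i, FiniteDimensional k (S i)] : FiniteDimensional k (Submodule.pi Set.univ S) := by
  refine FiniteDimensional.of_injective
    (LinearMap.pi fun i => (LinearMap.proj i ∘ₗ (Submodule.pi Set.univ S).subtype).codRestrict
      (S i) fun f => f.2 i trivial) fun f g h => ?_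
  ext i
  exact congrArg Subtype.val (congrFun h i)

instance {ι : Type*} [Finite ι] (d : ι → ℤ) (n : ℤ) [∀ n, FiniteDimensional k (𝒜 n)] :
    FiniteDimensional k (freeDeg 𝒜 d n) :=
  Submodule.finiteDimensional_pi _

/-- The matrices of homogeneous maps of free right modules. -/
def matDeg {ι ρ : Type*} (d : ι → ℤ) (e : ρ → ℤ) : Submodule k (ι → ρ → A) :=
  Submodule.pi Set.univ fun i => Submodule.pi Set.univ fun r => intDeg 𝒜 (e r - d i)

theorem mem_matDeg {ι ρ : Type*} {d : ι → ℤ} {e : ρ → ℤ} {u : ι → ρ → A} :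
    u ∈ matDeg 𝒜 d e ↔ ∀ i r, u i r ∈ intDeg 𝒜 (e r - d i) := by
  simp [matDeg, Submodule.mem_pi]

instance {ι ρ : Type*} [Finite ι] [Finite ρ] (d : ι → ℤ) (e : ρ → ℤ)
    [∀ n, FiniteDimensional k (𝒜 n)] : FiniteDimensional k (matDeg 𝒜 d e) :=
  have (i : ι) : FiniteDimensional k
      (Submodule.pi Set.univ fun r => intDeg 𝒜 (e r - d i) : Submodule k (ρ → A)) :=
    Submodule.finiteDimensional_pi _
  Submodule.finiteDimensional_pi _

/-- The map of free right modules with a given matrix, linear in the matrix. -/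
def matMap (k : Type*) [Field k] {A : Type*} [Ring A] [Algebra k A] (ι ρ : Type*) [Fintype ρ] :
    (ι → ρ → A) →ₗ[k] (ρ → A) →ₗ[k] (ι → A) :=
  LinearMap.mk₂ k (fun u a i => ∑ r, u i r * a r)
    (fun _ _ _ => by ext; simp [add_mul, Finset.sum_add_distrib])
    (fun _ _ _ => by ext; simp [Finset.smul_sum])
    (fun _ _ _ => by ext; simp [mul_add, Finset.sum_add_distrib])
    (fun _ _ _ => by ext; simp [Finset.smul_sum])

theorem matMap_apply {ι ρ : Type*} [Fintype ρ] (u : ι → ρ → A) (a : ρ → A) (i : ι) :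
    matMap k ι ρ u a i = ∑ r, u i r * a r := rfl

section

variable {N : Type*} [AddCommGroup N] [Module k N] [Module Aᵐᵒᵖ N] [IsScalarTower k Aᵐᵒᵖ N]

/-- The map from a free right module given by the images of the basis vectors. -/
def genMap (k : Type*) [Field k] {A : Type*} [Ring A] [Algebra k A] {N : Type*} [AddCommGroup N]
    [Module k N] [Module Aᵐᵒᵖ N] [IsScalarTower k Aᵐᵒᵖ N] {ι : Type*} [Fintype ι] (x : ι → N) :
    (ι → A) →ₗ[k] N where
  toFun f := ∑ i, op (f i) • x i
  map_add' f g := by simp [add_smul, Finset.sum_add_distrib]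
  map_smul' c f := by simp [Finset.smul_sum]

theorem genMap_apply {ι : Type*} [Fintype ι] (x : ι → N) (f : ι → A) :
    genMap k x f = ∑ i, op (f i) • x i := rfl

theorem genMap_smul {ι : Type*} [Fintype ι] (x : ι → N) (f : ι → A) (b : A) :
    genMap k x (op b • f) = op b • genMap k x f := by
  simp [genMap_apply, Finset.smul_sum, smul_smul]

theorem genMap_mem {deg : ℤ → Submodule k N}
    (hsm : ∀ i j a x, a ∈ intDeg 𝒜 i → x ∈ deg j → op a • x ∈ deg (j + i))
    {ι : Type*} [Fintype ι] {d : ι → ℤ} {x : ι → N} (hx : ∀ i, x i ∈ deg (d i)) {n : ℤ}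
    {f : ι → A} (hf : f ∈ freeDeg 𝒜 d n) : genMap k x f ∈ deg n := by
  rw [mem_freeDeg] at hf
  refine Submodule.sum_mem _ fun i _ => ?_
  have := hsm _ _ _ _ (hf i) (hx i)
  rwa [add_sub_cancel] at this

end

variable [GradedAlgebra 𝒜]

theorem mul_mem_intDeg {i j : ℤ} {a b : A} (ha : a ∈ intDeg 𝒜 i) (hb : b ∈ intDeg 𝒜 j) :
    a * b ∈ intDeg 𝒜 (i + j) := by
  rcases lt_or_ge i 0 with hi | hi
  · rw [intDeg_of_neg 𝒜 hi, Submodule.mem_bot] at ha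
    simp [ha]
  rcases lt_or_ge j 0 with hj | hj
  · rw [intDeg_of_neg 𝒜 hj, Submodule.mem_bot] at hb
    simp [hb]
  lift i to ℕ using hi
  lift j to ℕ using hj
  rw [← Nat.cast_add, intDeg_natCast]
  rw [intDeg_natCast] at ha hb
  exact SetLike.mul_mem_graded ha hb

theorem proj_eq_ite {i : ℕ} {n : ℕ} {a : A} (ha : a ∈ 𝒜 i) :
    GradedAlgebra.proj 𝒜 n a = if i = n then a else 0 := by
  rw [GradedAlgebra.proj_apply]
  split_ifs with h
  · subst h
    exact DirectSum.decompose_of_mem_same 𝒜 ha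
  · exact DirectSum.decompose_of_mem_ne 𝒜 ha h

theorem proj_mem (n : ℕ) (a : A) : GradedAlgebra.proj 𝒜 n a ∈ 𝒜 n := by
  rw [GradedAlgebra.proj_apply]
  exact (DirectSum.decompose 𝒜 a n).2

theorem isGrading_intDeg : IsGrading (intDeg 𝒜) := by
  refine ⟨?_, fun n => if 0 ≤ n then GradedAlgebra.proj 𝒜 n.toNat else 0, ?_⟩
  · rw [eq_top_iff, ← (DirectSum.Decomposition.isInternal 𝒜).submodule_iSup_eq_top]
    exact iSup_le fun n => (intDeg_natCast 𝒜 n).symm.le.trans (le_iSup (intDeg 𝒜) n)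
  · intro n m x hx
    rcases lt_or_ge m 0 with hm | hm
    · rw [intDeg_of_neg 𝒜 hm, Submodule.mem_bot] at hx
      simp [hx]
    lift m to ℕ using hm
    rw [intDeg_natCast] at hx
    rcases lt_or_ge n 0 with hn | hn
    · simp [hn.not_ge, show (m : ℤ) ≠ n by omega]
    lift n to ℕ using hn
    simp [proj_eq_ite 𝒜 hx]

theorem isGrading_freeDeg {ι : Type*} [Finite ι] (d : ι → ℤ) : IsGrading (freeDeg 𝒜 d) := by
  classical
  have := Fintype.ofFinite ι
  obtain ⟨p, hp⟩ := (isGrading_intDeg 𝒜).exists_proj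
  refine ⟨eq_top_iff.2 fun f _ => ?_,
    fun n => LinearMap.pi fun i => p (n - d i) ∘ₗ LinearMap.proj i, fun n m f hf => ?_⟩
  · rw [← Finset.univ_sum_single f]
    refine Submodule.sum_mem _ fun i _ => ?_
    have hi : f i ∈ ⨆ j, intDeg 𝒜 j := (isGrading_intDeg 𝒜).iSup_eq_top ▸ Submodule.mem_top
    have hle : (⨆ j, intDeg 𝒜 j) ≤
        (⨆ j, freeDeg 𝒜 d j).comap (LinearMap.single k (fun _ => A) i) := by
      refine iSup_le fun j a ha => Submodule.mem_iSup_of_mem (j + d i) ?_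
      rw [mem_freeDeg]
      intro i'
      rcases eq_or_ne i' i with rfl | h
      · simpa using ha
      · simp [h]
    exact hle hi
  · rw [mem_freeDeg] at hf
    ext i
    simp only [LinearMap.pi_apply, LinearMap.comp_apply, LinearMap.proj_apply]
    rw [hp _ _ _ (hf i)]
    split_ifs with h1 h2 h2 <;> first | rfl | omega

theorem matMap_mem {ι ρ : Type*} [Fintype ρ] {d : ι → ℤ} {e : ρ → ℤ} {u : ι → ρ → A}
    (hu : u ∈ matDeg 𝒜 d e) {n : ℤ} {a : ρ → A} (ha : a ∈ freeDeg 𝒜 e n) :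
    matMap k ι ρ u a ∈ freeDeg 𝒜 d n := by
  rw [mem_matDeg] at hu
  rw [mem_freeDeg] at ha ⊢
  intro i
  refine Submodule.sum_mem _ fun r _ => ?_
  have := mul_mem_intDeg 𝒜 (hu i r) (ha r)
  rwa [show e r - d i + (n - e r) = n - d i by ring] at this

theorem mem_augIdeal_of_mem_intDeg {j : ℤ} (hj : 0 < j) {a : A} (ha : a ∈ intDeg 𝒜 j) :
    a ∈ augIdeal 𝒜 := by
  lift j to ℕ using hj.le
  rw [intDeg_natCast] at ha
  rw [augIdeal, LinearMap.mem_ker, proj_eq_ite 𝒜 ha, if_neg (by omega)]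

theorem augIdeal_le : augIdeal 𝒜 ≤ ⨆ i, 𝒜 (i + 1) := by
  classical
  intro a ha
  rw [← DirectSum.sum_support_decompose 𝒜 a]
  refine Submodule.sum_mem _ fun i hi => ?_
  cases i with
  | zero =>
    rw [DFinsupp.mem_support_iff] at hi
    refine absurd (Subtype.ext ?_) hi
    simpa [augIdeal, GradedAlgebra.proj_apply] using ha
  | succ i => exact Submodule.mem_iSup_of_mem i (DirectSum.decompose 𝒜 a (i + 1)).2

theorem iSup_mul_iSup_le (L : ℕ) :
    (⨆ i, 𝒜 (i + 1)) * (⨆ i, 𝒜 (i + L)) ≤ ⨆ i, 𝒜 (i + (L + 1)) := by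
  rw [Submodule.iSup_mul]
  refine iSup_le fun i => ?_
  rw [Submodule.mul_iSup]
  refine iSup_le fun j => Submodule.mul_le.2 fun a ha b hb =>
    Submodule.mem_iSup_of_mem (i + j) ?_
  have := SetLike.mul_mem_graded ha hb
  rwa [show i + 1 + (j + L) = i + j + (L + 1) by ring] at this

/-- By connectedness each algebra generator becomes an element of A₊ after subtracting a scalar. A
word of length L in these elements, homogeneous or not, lives in degrees at least L, so the degree
`n` parts of the finitely many words of length at most `n` span `𝒜 n`. -/
theorem finiteDimensional_component (hconn : IsConnectedGraded 𝒜)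
    (hfp : IsFinitelyPresentedAlgebra k A) (n : ℕ) : FiniteDimensional k (𝒜 n) := by
  obtain ⟨N, φ, -, hφ, -, -⟩ := hfp
  choose c hc using fun i => hconn.2 _ (proj_mem 𝒜 0 (φ (FreeAlgebra.ι k i)))
  let y : Fin N → A := fun i => φ (FreeAlgebra.ι k i) - algebraMap k A (c i)
  have hy (i : Fin N) : y i ∈ ⨆ i, 𝒜 (i + 1) := by
    refine augIdeal_le 𝒜 ?_
    rw [augIdeal, LinearMap.mem_ker, map_sub, hc,
      proj_eq_ite 𝒜 (SetLike.algebraMap_mem_graded 𝒜 (c i)), if_pos rfl, sub_self]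
  have hadj : Algebra.adjoin k (Set.range y) = ⊤ := by
    rw [eq_top_iff, ← (AlgHom.range_eq_top φ).2 hφ, ← Algebra.map_top, ← FreeAlgebra.adjoin_range_ι,
      AlgHom.map_adjoin, Algebra.adjoin_le_iff]
    rintro _ ⟨_, ⟨i, rfl⟩, rfl⟩
    have : φ (FreeAlgebra.ι k i) = y i + algebraMap k A (c i) := by simp [y]
    rw [this]
    exact add_mem (Algebra.subset_adjoin ⟨i, rfl⟩) (Subalgebra.algebraMap_mem _ _)
  have hlist (l : List (Fin N)) : (l.map y).prod ∈ ⨆ i, 𝒜 (i + l.length) := by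
    induction l with
    | nil => exact Submodule.mem_iSup_of_mem 0 (by simpa using SetLike.one_mem_graded 𝒜)
    | cons i l ih =>
      rw [List.map_cons, List.prod_cons]
      exact iSup_mul_iSup_le 𝒜 l.length (Submodule.mul_mem_mul (hy i) ih)
  have hfin : ((fun l : List (Fin N) => GradedAlgebra.proj 𝒜 n (l.map y).prod) ''
      {l | l.length ≤ n}).Finite := (List.finite_length_le _ _).image _
  have := FiniteDimensional.span_of_finite k hfin
  refine Submodule.finiteDimensional_of_le (S₂ := Submodule.span k
    ((fun l : List (Fin N) => GradedAlgebra.proj 𝒜 n (l.map y).prod) ''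
      {l | l.length ≤ n})) (fun a ha => ?_)
  have hle : (⊤ : Submodule k A) ≤ (Submodule.span k
      ((fun l : List (Fin N) => GradedAlgebra.proj 𝒜 n (l.map y).prod) ''
      {l | l.length ≤ n})).comap (GradedAlgebra.proj 𝒜 n) := by
    rw [← Algebra.top_toSubmodule, ← hadj, Algebra.adjoin_eq_span, Submodule.span_le]
    intro b hb
    obtain ⟨l, hl, rfl⟩ := Submonoid.exists_list_of_mem_closure hb
    obtain ⟨l, rfl⟩ : ∃ l' : List (Fin N), l = l'.map y := by
      have : l ∈ Set.range (List.map y) := by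
        rw [Set.range_list_map]
        exact hl
      obtain ⟨l', h⟩ := this
      exact ⟨l', h.symm⟩
    rcases le_or_gt l.length n with h | h
    · exact Submodule.subset_span ⟨l, h, rfl⟩
    · have h0 : (⨆ i, 𝒜 (i + l.length)) ≤ LinearMap.ker (GradedAlgebra.proj 𝒜 n) :=
        iSup_le fun i a ha => by
          rw [LinearMap.mem_ker, proj_eq_ite 𝒜 ha, if_neg (by omega)]
      rw [SetLike.mem_coe, Submodule.mem_comap, LinearMap.mem_ker.1 (h0 (hlist l))]
      exact zero_mem _
  have := hle (Submodule.mem_top (x := a))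
  rwa [Submodule.mem_comap, proj_eq_ite 𝒜 ha, if_pos rfl] at this

section

variable {N : Type*} [AddCommGroup N] [Module k N] [Module Aᵐᵒᵖ N] [IsScalarTower k Aᵐᵒᵖ N]
  {deg : ℤ → Submodule k N}

/-- The multiplication by a fixed element of a right module, `a ↦ x a`. -/
def smulMap (k : Type*) [Field k] (A : Type*) [Ring A] [Algebra k A] {N : Type*} [AddCommGroup N]
    [Module k N] [Module Aᵐᵒᵖ N] [IsScalarTower k Aᵐᵒᵖ N] : N →ₗ[k] A →ₗ[k] N :=
  LinearMap.mk₂ k (fun x a => op a • x) (fun _ _ _ => smul_add _ _ _)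
    (fun c x a => smul_comm (op a) c x) (fun x a b => add_smul (op a) (op b) x)
    (fun c x a => smul_assoc c (op a) x)

theorem smulMap_apply (x : N) (a : A) : smulMap k A x a = op a • x := rfl

/-- A graded form of Nakayama's lemma. -/
theorem IsGrading.inf_le_map_genMap (h : IsGrading deg)
    (hsm : ∀ i j a x, a ∈ intDeg 𝒜 i → x ∈ deg j → op a • x ∈ deg (j + i))
    (S : Submodule k N) (hS : S ≤ ⨆ j, S ⊓ deg j) (p D : ℤ)
    (hp : ∀ n < p, S ⊓ deg n ≤ ⊥) {ι : Type*} [Fintype ι] (d : ι → ℤ) (x : ι → N)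
    (hgen : ∀ n ≤ D, S ⊓ deg n ≤ Submodule.span k {y | ∃ i, d i = n ∧ x i = y})
    (hnak : ∀ n > D, S ⊓ deg n ≤
      Submodule.span k {z | ∃ y ∈ S, ∃ a ∈ augIdeal 𝒜, op a • y = z}) (n : ℤ) :
    S ⊓ deg n ≤ (freeDeg 𝒜 d n).map (genMap k x) := by
  classical
  obtain ⟨P, hP⟩ := h.exists_proj
  -- Strong induction on the degree, starting from `p`, below which `S` vanishes.
  suffices H : ∀ (t : ℕ) (n : ℤ), n < p + t →
      S ⊓ deg n ≤ (freeDeg 𝒜 d n).map (genMap k x) from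
    H (n - p + 1).toNat n (by omega)
  intro t
  induction t with
  | zero => exact fun n hn => (hp n (by simpa using hn)).trans bot_le
  | succ t ih =>
    intro n hn
    rcases le_or_gt n D with hD | hD
    · refine (hgen n hD).trans (Submodule.span_le.2 ?_)
      rintro _ ⟨i, hi, rfl⟩
      refine ⟨Pi.single i 1, (mem_freeDeg 𝒜).2 fun i' => ?_, ?_⟩
      · rcases eq_or_ne i' i with rfl | h
        · rw [hi, sub_self, Pi.single_eq_same, ← Nat.cast_zero, intDeg_natCast]
          exact SetLike.one_mem_graded 𝒜
        · rw [Pi.single_eq_of_ne h]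
          exact zero_mem _
      · rw [genMap_apply, Finset.sum_eq_single i (fun i' _ h => by simp [h]) (by simp)]
        simp
    · intro y hy
      -- The factors of the products spanning S A₊ need not be homogeneous. Projecting to degree `n`
      -- leaves products of a component of `S` of degree less than `n` with an element of positive
      -- degree, to which induction applies.
      have hspan : Submodule.span k {z | ∃ y ∈ S, ∃ a ∈ augIdeal 𝒜, op a • y = z} ≤
          ((freeDeg 𝒜 d n).map (genMap k x)).comap (P n) := by
        refine Submodule.span_le.2 ?_
        rintro _ ⟨w, hw, a, ha, rfl⟩
        have hle : ∀ j, ∀ w ∈ S ⊓ deg j, augIdeal 𝒜 ≤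
            ((freeDeg 𝒜 d n).map (genMap k x)).comap (P n ∘ₗ smulMap k A w) := by
          intro j w hw
          refine (augIdeal_le 𝒜).trans (iSup_le fun i a ha => ?_)
          rw [← intDeg_natCast 𝒜] at ha
          rw [Submodule.mem_comap, LinearMap.comp_apply, smulMap_apply,
            hP _ _ _ (hsm _ _ _ _ ha hw.2)]
          split_ifs with hj
          · obtain ⟨f, hf, rfl⟩ := ih j (by push_cast at hj hn; omega) hw
            refine ⟨op a • f, (mem_freeDeg 𝒜).2 fun i' => ?_, genMap_smul x f a⟩
            have := mul_mem_intDeg 𝒜 ((mem_freeDeg 𝒜).1 hf i') ha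
            rwa [show j - d i' + ((i + 1 : ℕ) : ℤ) = n - d i' by omega] at this
          · exact zero_mem _
        have hle' : (⨆ j, S ⊓ deg j) ≤
            ((freeDeg 𝒜 d n).map (genMap k x)).comap (P n ∘ₗ (smulMap k A).flip a) :=
          iSup_le fun j w hw => hle j w hw ha
        exact hle' (hS hw)
      have := hspan (hnak n hD hy)
      rwa [Submodule.mem_comap, hP _ _ _ hy.2, if_pos rfl] at this

/-- A bound for the dimension of the components of a module with `m` generators. -/
theorem IsGrading.finrank_le [∀ n, FiniteDimensional k (𝒜 n)] (h : IsGrading deg)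
    (hsm : ∀ i j a x, a ∈ intDeg 𝒜 i → x ∈ deg j → op a • x ∈ deg (j + i))
    (p : ℤ) (hp : ∀ n < p, deg n = ⊥) {m : ℕ} (s : Fin m → N)
    (hs : Submodule.span Aᵐᵒᵖ (Set.range s) = ⊤) (j : ℤ) :
    FiniteDimensional k (deg j) ∧
      finrank k (deg j) ≤ finrank k (Fin m → ∀ i : Fin (j - p + 1).toNat, 𝒜 i) := by
  classical
  obtain ⟨P, hP⟩ := h.exists_proj
  -- The generators `s a` need not be homogeneous. The degree `j` part of `s a` times `b` is the sum
  -- over `i` of the degree `j - i` part of `s a` times the degree `i` part of `b`, and only 0 ≤ i ≤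
  -- j - p contribute.
  let Φ : (Fin m → ∀ i : Fin (j - p + 1).toNat, 𝒜 i) →ₗ[k] N :=
    ∑ a, ∑ i : Fin (j - p + 1).toNat, smulMap k A (P (j - (i : ℕ)) (s a)) ∘ₗ (𝒜 i).subtype ∘ₗ
      (LinearMap.proj i ∘ₗ LinearMap.proj a)
  have key : ∀ (x : N) (b : A), P j (op b • x) =
      ∑ i : Fin (j - p + 1).toNat, op (GradedAlgebra.proj 𝒜 i b) • P (j - i) x := by
    have h1 : P j ∘ₗ TensorProduct.lift (smulMap k A (N := N)) =
        TensorProduct.lift (∑ i : Fin (j - p + 1).toNat,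
          (smulMap k A).compl₁₂ (P (j - i)) (GradedAlgebra.proj 𝒜 i)) := by
      refine TensorProduct.ext' fun x b => ?_
      have hx : x ∈ ⨆ j, deg j := h.iSup_eq_top ▸ Submodule.mem_top
      have hb : b ∈ ⨆ j, 𝒜 j :=
        (DirectSum.Decomposition.isInternal 𝒜).submodule_iSup_eq_top ▸ Submodule.mem_top
      induction hx using Submodule.iSup_induction' with
      | zero => simp
      | add x y _ _ hx hy => simp only [TensorProduct.add_tmul, map_add, hx, hy]
      | mem l x hx =>
        induction hb using Submodule.iSup_induction' with
        | zero => simp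
        | add x y _ _ hx hy => simp only [TensorProduct.tmul_add, map_add, hx, hy]
        | mem t b hb =>
          have hb' := hb
          rw [← intDeg_natCast 𝒜] at hb'
          simp only [LinearMap.comp_apply, TensorProduct.lift.tmul, smulMap_apply,
            hP _ _ _ (hsm _ _ _ _ hb' hx), LinearMap.sum_apply, LinearMap.compl₁₂_apply,
            hP _ _ _ hx, proj_eq_ite 𝒜 hb]
          split_ifs with hlt
          · rcases lt_or_ge l p with hl | hl
            · rw [hp l hl, Submodule.mem_bot] at hx
              simp [hx]
            · rw [Finset.sum_eq_single (⟨t, by omega⟩ : Fin (j - p + 1).toNat)]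
              · simp [show l = j - t by omega]
              · intro i _ hi
                rw [if_neg (fun h => hi (Fin.ext h.symm))]
                simp
              · simp
          · refine (Finset.sum_eq_zero fun i _ => ?_).symm
            by_cases ht : t = i
            · rw [if_pos ht, if_neg (by omega), smul_zero]
            · rw [if_neg ht]
              simp
    intro x b
    simpa [smulMap_apply, LinearMap.sum_apply] using LinearMap.congr_fun h1 (x ⊗ₜ b)
  have hle : deg j ≤ LinearMap.range Φ := by
    intro x hx
    obtain ⟨c, hc⟩ := (Submodule.mem_span_range_iff_exists_fun Aᵐᵒᵖ).1
      (hs ▸ Submodule.mem_top : x ∈ Submodule.span Aᵐᵒᵖ (Set.range s))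
    refine ⟨fun a i => ⟨_, proj_mem 𝒜 i (unop (c a))⟩, ?_⟩
    have hx' : P j x = x := by rw [hP _ _ _ hx, if_pos rfl]
    rw [← hx', ← hc, map_sum]
    simp only [Φ, LinearMap.sum_apply]
    refine Finset.sum_congr rfl fun a _ => ?_
    rw [← op_unop (c a), key]
    rfl
  have : FiniteDimensional k (deg j) := Submodule.finiteDimensional_of_le hle
  exact ⟨this, (Submodule.finrank_mono hle).trans (LinearMap.finrank_range_le Φ)⟩

end

end Gradings

/-! ### Diagram chases from bar boundaries to syzygies. -/

section BarChase

open Module MulOpposite LinearMap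

variable {k : Type*} [Field k] {A : Type*} [Ring A] [Algebra k A] (𝒜 : ℕ → Submodule k A)
  [GradedAlgebra 𝒜]
  (N : Type*) [AddCommGroup N] [Module k N] [Module Aᵐᵒᵖ N] [IsScalarTower k Aᵐᵒᵖ N]
  {N' : Type*} [AddCommGroup N'] [Module k N'] [Module Aᵐᵒᵖ N'] [IsScalarTower k Aᵐᵒᵖ N']
  {N'' : Type*} [AddCommGroup N''] [Module k N''] [Module Aᵐᵒᵖ N''] [IsScalarTower k Aᵐᵒᵖ N'']
  (X : Type*) [AddCommGroup X] [Module k X] {X' : Type*} [AddCommGroup X'] [Module k X']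

/-- The multiplication `N ⊗ A₊ → N` of a right module. -/
noncomputable def rightAct : (N ⊗[k] augIdeal 𝒜) →ₗ[k] N :=
  TensorProduct.lift ((smulMap k A).compl₂ (augIdeal 𝒜).subtype)

/-- The multiplication of the last two factors of `X ⊗ A₊ ⊗ A₊`. -/
noncomputable def lastMul : ((X ⊗[k] augIdeal 𝒜) ⊗[k] augIdeal 𝒜) →ₗ[k] X ⊗[k] augIdeal 𝒜 :=
  lTensor X (augMul 𝒜) ∘ₗ (TensorProduct.assoc k X (augIdeal 𝒜) (augIdeal 𝒜)).toLinearMap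

/-- The bar differential `N ⊗ A₊ ⊗ A₊ → N ⊗ A₊`. -/
noncomputable def rightBarTwo :
    ((N ⊗[k] augIdeal 𝒜) ⊗[k] augIdeal 𝒜) →ₗ[k] N ⊗[k] augIdeal 𝒜 :=
  rTensor (augIdeal 𝒜) (rightAct 𝒜 N) - lastMul 𝒜 N

/-- The bar differential `N ⊗ A₊ ⊗ A₊ ⊗ A₊ → N ⊗ A₊ ⊗ A₊`. -/
noncomputable def rightBarThree :
    (((N ⊗[k] augIdeal 𝒜) ⊗[k] augIdeal 𝒜) ⊗[k] augIdeal 𝒜) →ₗ[k]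
      (N ⊗[k] augIdeal 𝒜) ⊗[k] augIdeal 𝒜 :=
  rTensor (augIdeal 𝒜) (rightBarTwo 𝒜 N) + lastMul 𝒜 (N ⊗[k] augIdeal 𝒜)

variable {N X}

@[simp] theorem rightAct_tmul (x : N) (a : augIdeal 𝒜) :
    rightAct 𝒜 N (x ⊗ₜ[k] a) = op a.1 • x := rfl

@[simp] theorem lastMul_tmul (x : X) (a b : augIdeal 𝒜) :
    lastMul 𝒜 X ((x ⊗ₜ[k] a) ⊗ₜ[k] b) = x ⊗ₜ augMul 𝒜 (a ⊗ₜ b) := rfl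

theorem coe_augMul (a b : augIdeal 𝒜) : (augMul 𝒜 (a ⊗ₜ b) : A) = a * b := rfl

theorem augMul_assoc (a b c : augIdeal 𝒜) :
    augMul 𝒜 (augMul 𝒜 (a ⊗ₜ b) ⊗ₜ c) = augMul 𝒜 (a ⊗ₜ augMul 𝒜 (b ⊗ₜ c)) :=
  Subtype.ext (mul_assoc a.1 b.1 c.1)

@[simp] theorem rightBarTwo_tmul (x : N) (a b : augIdeal 𝒜) :
    rightBarTwo 𝒜 N ((x ⊗ₜ[k] a) ⊗ₜ[k] b) =
      (op a.1 • x) ⊗ₜ b - x ⊗ₜ augMul 𝒜 (a ⊗ₜ b) := rfl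

@[simp] theorem rightBarThree_tmul (t : (N ⊗[k] augIdeal 𝒜) ⊗[k] augIdeal 𝒜) (b : augIdeal 𝒜) :
    rightBarThree 𝒜 N (t ⊗ₜ[k] b) =
      rightBarTwo 𝒜 N t ⊗ₜ b + lastMul 𝒜 (N ⊗[k] augIdeal 𝒜) (t ⊗ₜ b) := rfl

theorem rightAct_rightBarTwo (t : (N ⊗[k] augIdeal 𝒜) ⊗[k] augIdeal 𝒜) :
    rightAct 𝒜 N (rightBarTwo 𝒜 N t) = 0 := by
  suffices h : rightAct 𝒜 N ∘ₗ rightBarTwo 𝒜 N = 0 from LinearMap.congr_fun h t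
  ext x a b
  simp [coe_augMul, smul_smul]

theorem rightBarTwo_rightBarThree
    (t : ((N ⊗[k] augIdeal 𝒜) ⊗[k] augIdeal 𝒜) ⊗[k] augIdeal 𝒜) :
    rightBarTwo 𝒜 N (rightBarThree 𝒜 N t) = 0 := by
  suffices h : rightBarTwo 𝒜 N ∘ₗ rightBarThree 𝒜 N = 0 from LinearMap.congr_fun h t
  ext x a b c
  simp [coe_augMul, smul_smul, TensorProduct.sub_tmul, augMul_assoc]

omit [Module Aᵐᵒᵖ N'] [IsScalarTower k Aᵐᵒᵖ N'] in
/-- The kernel of `N ⊗ A₊ → N' ⊗ A₊` acts through `(ker f) A₊`. -/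
theorem rightAct_mem_span_of_rTensor_eq_zero (f : N →ₗ[k] N') (t : N ⊗[k] augIdeal 𝒜)
    (ht : rTensor (augIdeal 𝒜) f t = 0) :
    rightAct 𝒜 N t ∈ Submodule.span k
      {z | ∃ y ∈ LinearMap.ker f, ∃ a ∈ augIdeal 𝒜, op a • y = z} := by
  -- A₊ is flat over the field, so the kernel of f ⊗ A₊ is the image of (ker f) ⊗ A₊.
  obtain ⟨s, rfl⟩ := (Module.Flat.rTensor_exact (augIdeal 𝒜)
    (LinearMap.exact_subtype_ker_map f) t).1 ht
  induction s using TensorProduct.induction_on with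
  | zero => simp
  | tmul x a => exact Submodule.subset_span ⟨x, x.2, a, a.2, rfl⟩
  | add x y hx hy =>
    have h0 (x : LinearMap.ker f ⊗[k] augIdeal 𝒜) :
        rTensor (augIdeal 𝒜) f (rTensor (augIdeal 𝒜) (LinearMap.ker f).subtype x) = 0 :=
      (Module.Flat.rTensor_exact (augIdeal 𝒜) (LinearMap.exact_subtype_ker_map f) _).2 ⟨x, rfl⟩
    rw [map_add, map_add]
    exact add_mem (hx (h0 x)) (hy (h0 y))

variable {f : N →ₗ[k] N'} (hf : ∀ (a : A) (x : N), f (op a • x) = op a • f x)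

include hf

theorem rightAct_rTensor (t : N ⊗[k] augIdeal 𝒜) :
    rightAct 𝒜 N' (rTensor (augIdeal 𝒜) f t) = f (rightAct 𝒜 N t) := by
  suffices h : rightAct 𝒜 N' ∘ₗ rTensor (augIdeal 𝒜) f = f ∘ₗ rightAct 𝒜 N from
    LinearMap.congr_fun h t
  ext x a
  simp [hf]

theorem rightBarTwo_rTensor (t : (N ⊗[k] augIdeal 𝒜) ⊗[k] augIdeal 𝒜) :
    rightBarTwo 𝒜 N' (rTensor (augIdeal 𝒜) (rTensor (augIdeal 𝒜) f) t) =
      rTensor (augIdeal 𝒜) f (rightBarTwo 𝒜 N t) := by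
  suffices h : rightBarTwo 𝒜 N' ∘ₗ rTensor (augIdeal 𝒜) (rTensor (augIdeal 𝒜) f) =
      rTensor (augIdeal 𝒜) f ∘ₗ rightBarTwo 𝒜 N from LinearMap.congr_fun h t
  ext x a b
  simp [hf]

theorem rightBarThree_rTensor (t : ((N ⊗[k] augIdeal 𝒜) ⊗[k] augIdeal 𝒜) ⊗[k] augIdeal 𝒜) :
    rightBarThree 𝒜 N' (rTensor (augIdeal 𝒜) (rTensor (augIdeal 𝒜)
      (rTensor (augIdeal 𝒜) f)) t) =
      rTensor (augIdeal 𝒜) (rTensor (augIdeal 𝒜) f) (rightBarThree 𝒜 N t) := by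
  suffices h : rightBarThree 𝒜 N' ∘ₗ rTensor (augIdeal 𝒜) (rTensor (augIdeal 𝒜)
      (rTensor (augIdeal 𝒜) f)) =
      rTensor (augIdeal 𝒜) (rTensor (augIdeal 𝒜) f) ∘ₗ rightBarThree 𝒜 N from
    LinearMap.congr_fun h t
  ext x a b c
  simp [hf, TensorProduct.sub_tmul]

/-- A chain bounding the image of `t` lifts through the surjection. Subtracting the boundary of the
lift makes `t` vanish under f ⊗ A₊ and does not alter its product, since multiplication kills
boundaries. -/
theorem rightAct_mem_span_of_boundary (hsurj : Function.Surjective f) (t : N ⊗[k] augIdeal 𝒜)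
    (ht : rTensor (augIdeal 𝒜) f t ∈ LinearMap.range (rightBarTwo 𝒜 N')) :
    rightAct 𝒜 N t ∈ Submodule.span k
      {z | ∃ y ∈ LinearMap.ker f, ∃ a ∈ augIdeal 𝒜, op a • y = z} := by
  obtain ⟨g, hg⟩ := ht
  obtain ⟨g, rfl⟩ := rTensor_surjective _ (rTensor_surjective _ hsurj) g
  rw [rightBarTwo_rTensor 𝒜 hf] at hg
  have := rightAct_mem_span_of_rTensor_eq_zero 𝒜 f (t - rightBarTwo 𝒜 N g)
    (by rw [map_sub, hg, sub_self])
  rwa [map_sub, rightAct_rightBarTwo, sub_zero] at this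

/-- Dimension shifting by one step: once a lifted boundary is subtracted, `s` dies in N'' and so, by
right exactness of the tensor product, comes from a chain `c` over N. Then `t` minus the boundary of
`c` is killed by f ⊗ A₊. -/
theorem rightAct_mem_span_of_boundary_of_exact {g : N' →ₗ[k] N''}
    (hg : ∀ (a : A) (x : N'), g (op a • x) = op a • g x)
    (hex : Function.Exact f g) (hsurj : Function.Surjective g) (t : N ⊗[k] augIdeal 𝒜)
    (s : (N' ⊗[k] augIdeal 𝒜) ⊗[k] augIdeal 𝒜)
    (hst : rightBarTwo 𝒜 N' s = rTensor (augIdeal 𝒜) f t)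
    (hs : rTensor (augIdeal 𝒜) (rTensor (augIdeal 𝒜) g) s ∈
      LinearMap.range (rightBarThree 𝒜 N'')) :
    rightAct 𝒜 N t ∈ Submodule.span k
      {z | ∃ y ∈ LinearMap.ker f, ∃ a ∈ augIdeal 𝒜, op a • y = z} := by
  obtain ⟨b, hb⟩ := hs
  obtain ⟨b, rfl⟩ := rTensor_surjective _ (rTensor_surjective _ (rTensor_surjective _ hsurj)) b
  rw [rightBarThree_rTensor 𝒜 hg] at hb
  obtain ⟨c, hc⟩ := (rTensor_exact (augIdeal 𝒜) (rTensor_exact (augIdeal 𝒜) hex hsurj)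
    (rTensor_surjective _ hsurj) (s - rightBarThree 𝒜 N' b)).1 (by rw [map_sub, hb, sub_self])
  have := rightAct_mem_span_of_rTensor_eq_zero 𝒜 f (t - rightBarTwo 𝒜 N c) (by
    rw [map_sub, ← rightBarTwo_rTensor 𝒜 hf, hc, map_sub, rightBarTwo_rightBarThree, sub_zero,
      hst, sub_self])
  rwa [map_sub, rightAct_rightBarTwo, sub_zero] at this

end BarChase

/-! ### Vanishing of Tor as exactness of the bar complex in high degrees. -/

namespace GradedRightModule

open Module MulOpposite

variable {k : Type u} [Field k] {A : Type v} [Ring A] [Algebra k A]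
  {𝒜 : ℕ → Submodule k A} [GradedAlgebra 𝒜] (M : GradedRightModule 𝒜)

omit [GradedAlgebra 𝒜] in
theorem smul_mem_intDeg (i j : ℤ) (a : A) (x : M.carrier) (ha : a ∈ intDeg 𝒜 i)
    (hx : x ∈ M.deg j) : op a • x ∈ M.deg (j + i) := by
  rcases lt_or_ge i 0 with hi | hi
  · rw [intDeg_of_neg 𝒜 hi, Submodule.mem_bot] at ha
    simp [ha]
  · lift i to ℕ using hi
    rw [intDeg_natCast] at ha
    exact M.smul_mem i j a x ha hx

theorem torDeg_eq_bot {n : ℕ} {p j : ℤ}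
    (h : M.maxDeg n ≤ ((p : WithTop ℤ) : WithBot (WithTop ℤ))) (hj : p < j) :
    M.torDeg n j = ⊥ := by
  by_contra hne
  have h1 : ((j : WithTop ℤ) : WithBot (WithTop ℤ)) ≤ M.maxDeg n := le_sSup ⟨j, rfl, hne⟩
  have h2 := h1.trans h
  rw [WithBot.coe_le_coe, WithTop.coe_le_coe] at h2
  omega

theorem mem_range_of_torDeg_eq_bot {n : ℕ} {j : ℤ} (h : M.torDeg n j = ⊥) {t : M.barObj n}
    (ht : t ∈ M.barCycles n) (htj : t ∈ M.barDeg n j) : t ∈ LinearMap.range (M.barD n) := by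
  have hm : (M.barBoundaries n).mkQ ⟨t, ht⟩ ∈ M.torDeg n j := Submodule.mem_map_of_mem htj
  rw [h, Submodule.mem_bot, Submodule.mkQ_apply, Submodule.Quotient.mk_eq_zero] at hm
  exact hm

theorem tmul_mem_barDeg {n : ℕ} {i j : ℤ} {t : M.barObj n} (ht : t ∈ M.barDeg n j)
    (a : augIdeal 𝒜) (ha : (a : A) ∈ intDeg 𝒜 i) :
    M.barSucc n (t ⊗ₜ a) ∈ M.barDeg (n + 1) (j + i) := by
  rcases lt_or_ge i 0 with hi | hi
  · rw [intDeg_of_neg 𝒜 hi, Submodule.mem_bot] at ha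
    rw [show a = 0 from Subtype.ext ha, TensorProduct.tmul_zero, map_zero]
    exact zero_mem _
  · lift i to ℕ using hi
    rw [intDeg_natCast] at ha
    refine Submodule.mem_iSup_of_mem i (Submodule.mem_map_of_mem
      (Submodule.apply_mem_map₂ _ ?_ ha))
    rwa [add_sub_cancel_right]

theorem mem_range_rightAct {p j : ℤ}
    (h : M.maxDeg 0 ≤ ((p : WithTop ℤ) : WithBot (WithTop ℤ))) (hj : p < j) {x : M.carrier}
    (hx : x ∈ M.deg j) : x ∈ LinearMap.range (rightAct 𝒜 M.carrier) :=
  M.mem_range_of_torDeg_eq_bot (n := 0) (M.torDeg_eq_bot h hj) trivial hx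

/-- The chases also run through bar chains of free modules that carry no `GradedRightModule`
structure, so the differential is matched with one defined for arbitrary right modules. -/
theorem barD_one (t : (M.carrier ⊗[k] augIdeal 𝒜) ⊗[k] augIdeal 𝒜) :
    M.barD 1 t = rightBarTwo 𝒜 M.carrier t := by
  suffices h : (show (M.carrier ⊗[k] augIdeal 𝒜) ⊗[k] augIdeal 𝒜 →ₗ[k]
      M.carrier ⊗[k] augIdeal 𝒜 from M.barD 1) = rightBarTwo 𝒜 M.carrier from
    LinearMap.congr_fun h t
  refine TensorProduct.ext_threefold fun x a b => ?_
  have h (x : M.barObj 0) : M.barD 1 (M.barSucc 1 (M.barSucc 0 (x ⊗ₜ[k] a) ⊗ₜ[k] b)) =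
      M.barSucc 0 (M.barAct 0 (x ⊗ₜ a) ⊗ₜ b) - M.barSucc 0 (x ⊗ₜ augMul 𝒜 (a ⊗ₜ b)) := by
    rw [barD_succ, barD_zero, barAct_succ, show (-1 : k) ^ (0 + 1) = -1 from pow_one _,
      neg_one_smul, sub_eq_add_neg]
  exact h x

theorem barD_two (t : ((M.carrier ⊗[k] augIdeal 𝒜) ⊗[k] augIdeal 𝒜) ⊗[k] augIdeal 𝒜) :
    M.barD 2 t = rightBarThree 𝒜 M.carrier t := by
  suffices h : (show ((M.carrier ⊗[k] augIdeal 𝒜) ⊗[k] augIdeal 𝒜) ⊗[k] augIdeal 𝒜 →ₗ[k]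
      (M.carrier ⊗[k] augIdeal 𝒜) ⊗[k] augIdeal 𝒜 from M.barD 2) =
      rightBarThree 𝒜 M.carrier from LinearMap.congr_fun h t
  refine TensorProduct.ext (TensorProduct.ext_threefold fun x a b => LinearMap.ext fun c => ?_)
  have h (t : M.barObj 1) : M.barD 2 (M.barSucc 2 (M.barSucc 1 (t ⊗ₜ[k] b) ⊗ₜ[k] c)) =
      M.barSucc 1 (M.barD 1 (M.barSucc 1 (t ⊗ₜ b)) ⊗ₜ c) +
        M.barSucc 1 (t ⊗ₜ augMul 𝒜 (b ⊗ₜ c)) := by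
    rw [barD_succ, barAct_succ, show (-1 : k) ^ (1 + 1) = 1 from neg_one_sq, one_smul]
  exact (h (x ⊗ₜ[k] a)).trans (congrArg (fun t : M.carrier ⊗[k] augIdeal 𝒜 =>
    t ⊗ₜ[k] c + (x ⊗ₜ[k] a) ⊗ₜ[k] augMul 𝒜 (b ⊗ₜ c)) (M.barD_one ((x ⊗ₜ a) ⊗ₜ b)))

theorem mem_range_rightBarTwo {p j : ℤ}
    (h : M.maxDeg 1 ≤ ((p : WithTop ℤ) : WithBot (WithTop ℤ))) (hj : p < j)
    {t : M.carrier ⊗[k] augIdeal 𝒜} (ht : rightAct 𝒜 M.carrier t = 0)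
    (htj : M.barSucc 0 t ∈ M.barDeg 1 j) : t ∈ LinearMap.range (rightBarTwo 𝒜 M.carrier) := by
  obtain ⟨s, hs⟩ := M.mem_range_of_torDeg_eq_bot (n := 1) (M.torDeg_eq_bot h hj) ht htj
  exact ⟨s, (M.barD_one s).symm.trans hs⟩

theorem mem_range_rightBarThree {p j : ℤ}
    (h : M.maxDeg 2 ≤ ((p : WithTop ℤ) : WithBot (WithTop ℤ))) (hj : p < j)
    {t : (M.carrier ⊗[k] augIdeal 𝒜) ⊗[k] augIdeal 𝒜} (ht : rightBarTwo 𝒜 M.carrier t = 0)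
    (htj : M.barSucc 1 t ∈ M.barDeg 2 j) :
    t ∈ LinearMap.range (rightBarThree 𝒜 M.carrier) := by
  obtain ⟨s, hs⟩ := M.mem_range_of_torDeg_eq_bot (n := 2) (M.torDeg_eq_bot h hj)
    ((M.barD_one t).trans ht) htj
  exact ⟨s, (M.barD_two s).symm.trans hs⟩

end GradedRightModule

/-! ### Uniform systems of generators, and bar chains of free modules. -/

section Generators

open Module MulOpposite

variable {k : Type*} [Field k]

theorem exists_fin_subset_range {N : Type*} [Zero N] (s : Finset N) {n : ℕ} (h : s.card ≤ n) :
    ∃ v : Fin n → N, (s : Set N) ⊆ Set.range v := by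
  refine ⟨fun i => if h : (i : ℕ) < s.card then s.equivFin.symm ⟨i, h⟩ else 0, fun x hx => ?_⟩
  refine ⟨⟨s.equivFin ⟨x, hx⟩, (s.equivFin ⟨x, hx⟩).2.trans_le h⟩, ?_⟩
  simp

theorem Submodule.exists_fin_le_span {N : Type*} [AddCommGroup N] [Module k N]
    (S : Submodule k N) [FiniteDimensional k S] {n : ℕ} (h : finrank k S ≤ n) :
    ∃ v : Fin n → N, (∀ i, v i ∈ S) ∧ S ≤ Submodule.span k (Set.range v) := by
  let b := finBasis k S
  refine ⟨fun i => if h : (i : ℕ) < finrank k S then b ⟨i, h⟩ else 0, fun i => ?_, fun x hx => ?_⟩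
  · dsimp only
    split_ifs
    · exact Subtype.coe_prop _
    · exact zero_mem _
  · have hx' := congrArg Subtype.val (b.sum_repr ⟨x, hx⟩)
    rw [AddSubmonoidClass.coe_finsetSum] at hx'
    change x ∈ _
    rw [show x = _ from hx'.symm]
    refine Submodule.sum_mem _ fun i _ => Submodule.smul_mem _ _
      (Submodule.subset_span ⟨⟨i, i.2.trans_le h⟩, ?_⟩)
    simp

/-- Index set for `C j` generators in each degree `j` between `p` and `D`. -/
abbrev GenIdx (p D : ℤ) (C : ℤ → ℕ) : Type := Σ j : Finset.Icc p D, Fin (C j)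

/-- The degrees of the generators. -/
def GenIdx.degree {p D : ℤ} {C : ℤ → ℕ} (i : GenIdx p D C) : ℤ := i.1

theorem GenIdx.le_degree {p D : ℤ} {C : ℤ → ℕ} (i : GenIdx p D C) : p ≤ i.degree :=
  (Finset.mem_Icc.1 i.1.2).1

theorem GenIdx.degree_le {p D : ℤ} {C : ℤ → ℕ} (i : GenIdx p D C) : i.degree ≤ D :=
  (Finset.mem_Icc.1 i.1.2).2

/-- The index set depends on `p`, `D` and `C` but not on `S`, which is what lets one free module
serve all modules at once; superfluous indices are filled with zero. -/
theorem exists_generators {N : Type*} [AddCommGroup N] [Module k N] (S : ℤ → Submodule k N)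
    (p D : ℤ) (C : ℤ → ℕ) (hp : ∀ n < p, S n ≤ ⊥) (hfin : ∀ j, FiniteDimensional k (S j))
    (hC : ∀ j, finrank k (S j) ≤ C j) :
    ∃ x : GenIdx p D C → N, (∀ i, x i ∈ S i.degree) ∧
      ∀ n ≤ D, S n ≤ Submodule.span k {y | ∃ i, GenIdx.degree i = n ∧ x i = y} := by
  choose v hv hspan using fun j => (S j).exists_fin_le_span (hC j)
  refine ⟨fun i => v i.1 i.2, fun i => hv _ _, fun n hn => ?_⟩
  rcases lt_or_ge n p with h | h
  · exact (hp n h).trans bot_le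
  · refine (hspan n).trans (Submodule.span_mono ?_)
    rintro _ ⟨i, rfl⟩
    exact ⟨⟨⟨n, Finset.mem_Icc.2 ⟨h, hn⟩⟩, i⟩, rfl, rfl⟩

variable {A : Type*} [Ring A] [Algebra k A] (𝒜 : ℕ → Submodule k A)

theorem freeDeg_of_lt {ι : Type*} {d : ι → ℤ} {n : ℤ} (h : ∀ i, n < d i) :
    freeDeg 𝒜 d n = ⊥ := by
  refine eq_bot_iff.2 fun f hf => ?_
  rw [Submodule.mem_bot]
  ext i
  have := (mem_freeDeg 𝒜).1 hf i
  rwa [intDeg_of_neg 𝒜 (by linarith [h i])] at this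

theorem matMap_eq_genMap {ι ρ : Type*} [Fintype ρ] (u : ρ → ι → A) :
    matMap k ι ρ (fun i r => u r i) = genMap k u := by
  ext a i
  simp [matMap_apply, genMap_apply]

variable [GradedAlgebra 𝒜]

theorem smul_mem_freeDeg {ι : Type*} (d : ι → ℤ) (i j : ℤ) (a : A) (f : ι → A)
    (ha : a ∈ intDeg 𝒜 i) (hf : f ∈ freeDeg 𝒜 d j) : op a • f ∈ freeDeg 𝒜 d (j + i) := by
  rw [mem_freeDeg] at hf ⊢
  intro t
  have := mul_mem_intDeg 𝒜 (hf t) ha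
  rwa [show j - d t + i = j + i - d t by ring] at this

/-- The element `∑ eᵢ ⊗ aᵢ` of `F ⊗ A₊`, for the basis `eᵢ` of a free right module `F`. -/
noncomputable def freeTensor {ι : Type*} [Fintype ι] [DecidableEq ι] (a : ι → augIdeal 𝒜) :
    (ι → A) ⊗[k] augIdeal 𝒜 :=
  ∑ i, (Pi.single i 1 : ι → A) ⊗ₜ a i

variable {ι : Type*} [Fintype ι] [DecidableEq ι]

theorem rightAct_freeTensor (a : ι → augIdeal 𝒜) :
    rightAct 𝒜 (ι → A) (freeTensor 𝒜 a) = fun i => (a i : A) := by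
  ext j
  simp [freeTensor, Pi.single_apply]

theorem rTensor_freeTensor {N : Type*} [AddCommGroup N] [Module k N] [Module Aᵐᵒᵖ N]
    [IsScalarTower k Aᵐᵒᵖ N] (x : ι → N) (a : ι → augIdeal 𝒜) :
    LinearMap.rTensor (augIdeal 𝒜) (genMap k x) (freeTensor 𝒜 a) = ∑ i, x i ⊗ₜ a i := by
  have h (i : ι) : genMap k x (Pi.single i (1 : A)) = x i := by
    rw [genMap_apply, Finset.sum_eq_single i (fun i' _ h => by simp [h]) (by simp)]
    simp
  simp [freeTensor, h]

/-- The component in `A₊` of an element of `A`. -/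
def toAugIdeal (b : A) : augIdeal 𝒜 :=
  ⟨b - GradedAlgebra.proj 𝒜 0 b, by
    rw [augIdeal, LinearMap.mem_ker, map_sub, proj_eq_ite 𝒜 (proj_mem 𝒜 0 b), if_pos rfl, sub_self]⟩

theorem coe_toAugIdeal (b : A) : (toAugIdeal 𝒜 b : A) = b - GradedAlgebra.proj 𝒜 0 b := rfl

theorem coe_toAugIdeal_mem {b : A} {j : ℤ} (hb : b ∈ intDeg 𝒜 j) :
    (toAugIdeal 𝒜 b : A) ∈ intDeg 𝒜 j := by
  refine sub_mem hb ?_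
  rcases lt_or_ge j 0 with hj | hj
  · rw [intDeg_of_neg 𝒜 hj, Submodule.mem_bot] at hb
    simp [hb]
  · lift j to ℕ using hj
    rw [intDeg_natCast] at hb ⊢
    rw [proj_eq_ite 𝒜 hb]
    split_ifs
    · exact hb
    · exact zero_mem _

/-- An explicit contraction of the bar complex of a free module in degree one. -/
theorem rightBarTwo_freeTensor (hconn : IsConnectedGraded 𝒜) {ρ : Type*} [Fintype ρ]
    (u : ρ → ι → A) (a : ρ → augIdeal 𝒜) (h : ∀ i, ∑ r, u r i * a r = 0) :
    rightBarTwo 𝒜 (ι → A) (∑ r, freeTensor 𝒜 (fun i => toAugIdeal 𝒜 (u r i)) ⊗ₜ[k] a r) =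
      ∑ r, u r ⊗ₜ[k] a r := by
  choose c hc using fun r i => hconn.2 _ (proj_mem 𝒜 0 (u r i))
  have h1 (r : ρ) : rightBarTwo 𝒜 (ι → A)
      (freeTensor 𝒜 (fun i => toAugIdeal 𝒜 (u r i)) ⊗ₜ[k] a r) =
      u r ⊗ₜ[k] a r - ∑ i, (Pi.single i 1 : ι → A) ⊗ₜ[k]
        (c r i • a r + augMul 𝒜 (toAugIdeal 𝒜 (u r i) ⊗ₜ a r)) := by
    have e1 : rightBarTwo 𝒜 (ι → A) (freeTensor 𝒜 (fun i => toAugIdeal 𝒜 (u r i)) ⊗ₜ[k] a r) =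
        rightAct 𝒜 (ι → A) (freeTensor 𝒜 (fun i => toAugIdeal 𝒜 (u r i))) ⊗ₜ[k] a r -
          ∑ i, (Pi.single i 1 : ι → A) ⊗ₜ[k] augMul 𝒜 (toAugIdeal 𝒜 (u r i) ⊗ₜ a r) := by
      simp [freeTensor, TensorProduct.sum_tmul, Finset.sum_sub_distrib]
    have e2 : rightAct 𝒜 (ι → A) (freeTensor 𝒜 (fun i => toAugIdeal 𝒜 (u r i))) =
        u r - ∑ i, c r i • (Pi.single i 1 : ι → A) := by
      rw [rightAct_freeTensor]
      ext i
      simp [coe_toAugIdeal, hc, Pi.single_apply, Algebra.algebraMap_eq_smul_one]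
    rw [e1, e2, TensorProduct.sub_tmul, TensorProduct.sum_tmul, sub_sub,
      ← Finset.sum_add_distrib]
    simp only [TensorProduct.tmul_add, TensorProduct.smul_tmul]
  rw [map_sum, Finset.sum_congr rfl fun r _ => h1 r, Finset.sum_sub_distrib, Finset.sum_comm,
    sub_eq_self]
  -- The scalar part and the A₊ part of `u r i` recombine, so the coefficient of the basis vector
  -- `i` is the sum over `r` of u r i * a r, which vanishes by `h`.
  refine Finset.sum_eq_zero fun i _ => ?_
  rw [← TensorProduct.tmul_sum]
  convert TensorProduct.tmul_zero (augIdeal 𝒜) (Pi.single i 1 : ι → A)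
  ext
  rw [AddSubmonoidClass.coe_finsetSum, ZeroMemClass.coe_zero, ← h i]
  refine Finset.sum_congr rfl fun r _ => ?_
  simp [coe_augMul, coe_toAugIdeal, hc, sub_mul, Algebra.smul_def]

end Generators

/-! ### Presentations of uniform shape and finiteness of the Hilbert series. -/

namespace GradedRightModule

open Module MulOpposite

variable {k : Type u} [Field k] {A : Type v} [Ring A] [Algebra k A]
  {𝒜 : ℕ → Submodule k A} [GradedAlgebra 𝒜] (M : GradedRightModule 𝒜)

theorem sum_tmul_mem_barDeg_one {ι : Type*} [Fintype ι] {d : ι → ℤ} {x : ι → M.carrier}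
    (hx : ∀ i, x i ∈ M.deg (d i)) {n : ℤ} {a : ι → augIdeal 𝒜}
    (ha : ∀ i, (a i : A) ∈ intDeg 𝒜 (n - d i)) :
    M.barSucc 0 (∑ i, x i ⊗ₜ[k] a i) ∈ M.barDeg 1 n := by
  refine Submodule.sum_mem (M.barDeg 1 n) (f := fun i => M.barSucc 0 (x i ⊗ₜ[k] a i)) fun i _ => ?_
  have := M.tmul_mem_barDeg (n := 0) (hx i) (a i) (ha i)
  rwa [add_sub_cancel] at this

theorem sum_tmul_mem_barDeg_two {ρ : Type*} [Fintype ρ] {e : ρ → ℤ}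
    {t : ρ → M.carrier ⊗[k] augIdeal 𝒜} (ht : ∀ r, M.barSucc 0 (t r) ∈ M.barDeg 1 (e r)) {n : ℤ}
    {a : ρ → augIdeal 𝒜} (ha : ∀ r, (a r : A) ∈ intDeg 𝒜 (n - e r)) :
    M.barSucc 1 (∑ r, t r ⊗ₜ[k] a r) ∈ M.barDeg 2 n := by
  refine Submodule.sum_mem (M.barDeg 2 n) (f := fun r => M.barSucc 1 (t r ⊗ₜ[k] a r)) fun r _ => ?_
  have := M.tmul_mem_barDeg (n := 1) (ht r) (a r) (ha r)
  rwa [add_sub_cancel] at this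

theorem mem_span_smul_of_maxDeg_zero {p n : ℤ}
    (h : M.maxDeg 0 ≤ ((p : WithTop ℤ) : WithBot (WithTop ℤ))) (hn : p < n) {x : M.carrier}
    (hx : x ∈ M.deg n) :
    x ∈ Submodule.span k {z | ∃ y ∈ (⊤ : Submodule k M.carrier), ∃ a ∈ augIdeal 𝒜,
      op a • y = z} := by
  obtain ⟨t, rfl⟩ := M.mem_range_rightAct h hn hx
  clear hx
  induction t using TensorProduct.induction_on with
  | zero => simp
  | tmul x a => exact Submodule.subset_span ⟨x, trivial, a, a.2, rfl⟩
  | add x y hx hy =>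
    rw [map_add]
    exact add_mem hx hy

/-- Since `n` exceeds all generator degrees, the coordinates of the relation `y` lie in A₊, and `y`
defines the bar chain ∑ xᵢ ⊗ yᵢ over M. It is a cycle because `y` is a relation, and a boundary
because Tor₁ vanishes in degree `n`. -/
theorem mem_span_smul_of_maxDeg_one {ι : Type*} [Fintype ι] [DecidableEq ι] {d : ι → ℤ}
    {x : ι → M.carrier} (hx : ∀ i, x i ∈ M.deg (d i))
    (hsurj : Function.Surjective (genMap k x : (ι → A) →ₗ[k] M.carrier))
    {q n : ℤ} (h : M.maxDeg 1 ≤ ((q : WithTop ℤ) : WithBot (WithTop ℤ))) (hn : q < n)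
    (hd : ∀ i, d i < n) {y : ι → A} (hy : genMap k x y = 0)
    (hyn : y ∈ freeDeg 𝒜 d n) :
    y ∈ Submodule.span k {z | ∃ y ∈ LinearMap.ker (genMap k x : (ι → A) →ₗ[k] M.carrier),
      ∃ a ∈ augIdeal 𝒜,
      op a • y = z} := by
  rw [mem_freeDeg] at hyn
  let a : ι → augIdeal 𝒜 := fun i =>
    ⟨y i, mem_augIdeal_of_mem_intDeg 𝒜 (sub_pos.2 (hd i)) (hyn i)⟩
  have hlin (b : A) (f : ι → A) : genMap k x (op b • f) = op b • genMap k x f := genMap_smul x f b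
  have hay : rightAct 𝒜 (ι → A) (freeTensor 𝒜 a) = y := rightAct_freeTensor 𝒜 a
  have := rightAct_mem_span_of_boundary 𝒜 hlin hsurj (freeTensor 𝒜 a) ?_
  · rwa [hay] at this
  · refine M.mem_range_rightBarTwo h hn ?_ ?_
    · rw [rightAct_rTensor 𝒜 hlin, hay, hy]
    · rw [rTensor_freeTensor]
      exact M.sum_tmul_mem_barDeg_one hx hyn

/-- The chain ∑ vᵣ ⊗ yᵣ over the free module is the boundary of the explicit chain of
`rightBarTwo_freeTensor`. The image of that chain over M is a 2-cycle, as each vᵣ maps to zero in M,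
and hence a boundary by vanishing of Tor₂ in degree `n`. -/
theorem mem_span_smul_of_maxDeg_two (hconn : IsConnectedGraded 𝒜) {ι ρ : Type*} [Fintype ι]
    [DecidableEq ι] [Fintype ρ] [DecidableEq ρ] {d : ι → ℤ} {e : ρ → ℤ}
    {x : ι → M.carrier} (hx : ∀ i, x i ∈ M.deg (d i))
    (hsurj : Function.Surjective (genMap k x : (ι → A) →ₗ[k] M.carrier))
    {v : ρ → ι → A} (hv : ∀ r, v r ∈ freeDeg 𝒜 d (e r))
    (hex : Function.Exact (genMap k v : (ρ → A) →ₗ[k] ι → A)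
      (genMap k x : (ι → A) →ₗ[k] M.carrier))
    {q n : ℤ} (h : M.maxDeg 2 ≤ ((q : WithTop ℤ) : WithBot (WithTop ℤ))) (hn : q < n)
    (he : ∀ r, e r < n) {y : ρ → A} (hy : genMap k v y = 0) (hyn : y ∈ freeDeg 𝒜 e n) :
    y ∈ Submodule.span k {z | ∃ y ∈ LinearMap.ker (genMap k v : (ρ → A) →ₗ[k] ι → A),
      ∃ a ∈ augIdeal 𝒜,
      op a • y = z} := by
  rw [mem_freeDeg] at hyn
  let a : ρ → augIdeal 𝒜 := fun r =>
    ⟨y r, mem_augIdeal_of_mem_intDeg 𝒜 (sub_pos.2 (he r)) (hyn r)⟩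
  have hlin (b : A) (f : ι → A) : genMap k x (op b • f) = op b • genMap k x f := genMap_smul x f b
  have hlin' (b : A) (f : ρ → A) : genMap k v (op b • f) = op b • genMap k v f := genMap_smul v f b
  have hay : rightAct 𝒜 (ρ → A) (freeTensor 𝒜 a) = y := rightAct_freeTensor 𝒜 a
  have hs := rightBarTwo_freeTensor 𝒜 hconn v a fun i => by
    simpa [genMap_apply, a] using congrFun hy i
  have hxv (r : ρ) : genMap k x (v r) = 0 := by
    refine (hex (v r)).2 ⟨Pi.single r 1, ?_⟩
    rw [genMap_apply, Finset.sum_eq_single r (fun i' _ h => by simp [h]) (by simp)]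
    simp
  have := rightAct_mem_span_of_boundary_of_exact 𝒜 hlin' hlin hex hsurj (freeTensor 𝒜 a)
    (∑ r, freeTensor 𝒜 (fun i => toAugIdeal 𝒜 (v r i)) ⊗ₜ[k] a r)
    (by rw [hs, rTensor_freeTensor]) ?_
  · rwa [hay] at this
  · refine M.mem_range_rightBarThree h hn ?_ ?_
    · rw [rightBarTwo_rTensor 𝒜 hlin, hs]
      simp [hxv]
    · simp only [map_sum, LinearMap.rTensor_tmul, rTensor_freeTensor]
      exact M.sum_tmul_mem_barDeg_two (fun r => M.sum_tmul_mem_barDeg_one hx fun i =>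
        coe_toAugIdeal_mem 𝒜 ((mem_freeDeg 𝒜).1 (hv r) i)) hyn

variable (𝒜) in
/-- The bound for the dimension of the component of degree `j` of a module with `m` generators
which vanishes below degree `p`. -/
noncomputable def dimBound (m p j : ℤ) : ℕ :=
  finrank k (Fin m.toNat → ∀ i : Fin (j - p + 1).toNat, 𝒜 i)

theorem finrank_deg_le [∀ n, FiniteDimensional k (𝒜 n)] {m p : ℤ} (hm : M.IsGeneratedByAtMost m)
    (hp : ∀ i : ℤ, i < p → M.deg i = ⊥) (j : ℤ) :
    FiniteDimensional k (M.deg j) ∧ finrank k (M.deg j) ≤ dimBound 𝒜 m p j := by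
  obtain ⟨s, hs, hspan⟩ := hm
  obtain ⟨v, hv⟩ := exists_fin_subset_range s (n := m.toNat) (by omega)
  exact M.isInternal.isGrading.finrank_le 𝒜 M.smul_mem_intDeg p hp v
    (eq_top_iff.2 (hspan ▸ Submodule.span_mono hv)) j

variable (𝒜)

/-- The degrees of a fixed free right module which maps onto all modules in `boundedModules`. -/
abbrev GenZero (m p₁ p₂ : ℤ) : Type := GenIdx p₁ p₂ (dimBound 𝒜 m p₁)

/-- The degrees of a free module mapping onto the relations. -/
abbrev GenOne (m p₁ p₂ q : ℤ) : Type :=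
  GenIdx p₁ (max q p₂) fun j => finrank k (freeDeg 𝒜 (GenIdx.degree (p := p₁) (D := p₂)
    (C := dimBound 𝒜 m p₁)) j)

/-- The degrees of a free module mapping onto the relations between relations. -/
abbrev GenTwo (m p₁ p₂ q r : ℤ) : Type :=
  GenIdx p₁ (max r (max q p₂)) fun j => finrank k (freeDeg 𝒜 (GenIdx.degree (p := p₁)
    (D := max q p₂) (C := fun j => finrank k (freeDeg 𝒜 (GenIdx.degree (p := p₁) (D := p₂)
      (C := dimBound 𝒜 m p₁)) j))) j)

variable {𝒜}

/-- `M` is the cokernel of a map of finitely generated free modules with generators of prescribed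
degrees, whose kernel also has generators of prescribed degrees. -/
def HasResolution {ι ρ σ : Type*} [Fintype ρ] [Fintype σ] (d : ι → ℤ) (e : ρ → ℤ)
    (f : σ → ℤ) : Prop :=
  ∃ u ∈ matDeg 𝒜 d e, ∃ l ∈ matDeg 𝒜 e f,
    (∀ n, finrank k (M.deg n) + finrank k ((freeDeg 𝒜 e n).map (matMap k ι ρ u)) =
      finrank k (freeDeg 𝒜 d n)) ∧
    (∀ b, matMap k ι ρ u (matMap k ρ σ l b) = 0) ∧
    ∀ n, (freeDeg 𝒜 f n).map (matMap k ρ σ l) =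
      freeDeg 𝒜 e n ⊓ LinearMap.ker (matMap k ι ρ u)

/-- The point is uniformity: all three degree functions are fixed by `𝒜` and the five integers,
independently of `M`. -/
theorem hasResolution_of_mem_boundedModules [∀ n, FiniteDimensional k (𝒜 n)]
    (hconn : IsConnectedGraded 𝒜) {m p₁ p₂ q r : ℤ} (hM : M ∈ boundedModules 𝒜 m p₁ p₂ q r) :
    M.HasResolution (GenIdx.degree : GenZero 𝒜 m p₁ p₂ → ℤ)
      (GenIdx.degree : GenOne 𝒜 m p₁ p₂ q → ℤ) (GenIdx.degree : GenTwo 𝒜 m p₁ p₂ q r → ℤ) := by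
  classical
  obtain ⟨-, hgen, hp, h0, h1, h2⟩ := hM
  have hg := M.isInternal.isGrading
  -- generators
  obtain ⟨x, hx, hxspan⟩ := exists_generators (fun j => ⊤ ⊓ M.deg j) p₁ p₂ (dimBound 𝒜 m p₁)
    (fun n hn => by simp [hp n hn])
    (fun j => by
      rw [top_inf_eq]
      exact (M.finrank_deg_le hgen hp j).1)
    (fun j => by
      rw [top_inf_eq]
      exact (M.finrank_deg_le hgen hp j).2)
  replace hx := fun i => (hx i).2
  have hxmap := hg.inf_le_map_genMap 𝒜 M.smul_mem_intDeg ⊤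
    (by simp [hg.iSup_eq_top]) p₁ p₂ (fun n hn => by simp [hp n hn]) GenIdx.degree x hxspan
    fun n hn y hy => M.mem_span_smul_of_maxDeg_zero h0 hn hy.2
  have hsurj : Function.Surjective (genMap k (A := A) x) := by
    rw [← LinearMap.range_eq_top, eq_top_iff, ← hg.iSup_eq_top]
    refine iSup_le fun n => le_trans ?_ ((hxmap n).trans (LinearMap.map_le_range))
    simp
  have hF := isGrading_freeDeg 𝒜 (GenIdx.degree : GenZero 𝒜 m p₁ p₂ → ℤ)
  have hxdeg : ∀ n, ∀ f ∈ freeDeg 𝒜 GenIdx.degree n, genMap k (A := A) x f ∈ M.deg n :=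
    fun n f hf => genMap_mem 𝒜 M.smul_mem_intDeg hx hf
  -- relations
  have hK := hF.ker_le hg (genMap k (A := A) x) hxdeg
  -- All relations up to the cutoff are spanned, not a minimal set of generators; the number needed
  -- in degree `j` is then at most the dimension of the free module in that degree, whatever `M` is.
  obtain ⟨v, hv, hvspan⟩ := exists_generators
    (fun j => LinearMap.ker (genMap k (A := A) x) ⊓ freeDeg 𝒜 GenIdx.degree j) p₁ (max q p₂)
    (fun j => finrank k (freeDeg 𝒜 (GenIdx.degree : GenZero 𝒜 m p₁ p₂ → ℤ) j))
    (fun n hn => by simp [freeDeg_of_lt 𝒜 fun i => hn.trans_le (GenIdx.le_degree i)])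
    (fun j => Submodule.finiteDimensional_inf_right _ _)
    (fun j => Submodule.finrank_mono inf_le_right)
  -- Beyond `max q p₂` the degree exceeds `q`, so Tor₁ vanishes, and exceeds every generator degree,
  -- so coordinates of relations lie in A₊. The next cutoff is chosen likewise.
  have hvmap := hF.inf_le_map_genMap 𝒜 (smul_mem_freeDeg 𝒜 _) _ hK p₁ (max q p₂)
    (fun n hn => by simp [freeDeg_of_lt 𝒜 fun i => hn.trans_le (GenIdx.le_degree i)])
    GenIdx.degree v hvspan
    fun n hn y hy => M.mem_span_smul_of_maxDeg_one hx hsurj h1 ((le_max_left _ _).trans_lt hn)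
      (fun i => (i.degree_le.trans (le_max_right _ _)).trans_lt hn) hy.1 hy.2
  have hxv : ∀ a, genMap k (A := A) x (genMap k (A := A) v a) = 0 := fun a => by
    rw [genMap_apply (k := k) v, map_sum]
    exact Finset.sum_eq_zero fun r _ => by
      rw [genMap_smul, LinearMap.mem_ker.1 (hv r).1, smul_zero]
  replace hv := fun i => (hv i).2
  have hex : Function.Exact (genMap k (A := A) v) (genMap k (A := A) x) := by
    refine fun f => ⟨fun hf => ?_, ?_⟩
    · exact iSup_le (fun n => (hvmap n).trans LinearMap.map_le_range) (hK hf)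
    · rintro ⟨a, rfl⟩
      exact hxv a
  have hG := isGrading_freeDeg 𝒜 (GenIdx.degree : GenOne 𝒜 m p₁ p₂ q → ℤ)
  have hvdeg : ∀ n, ∀ f ∈ freeDeg 𝒜 GenIdx.degree n,
      genMap k (A := A) v f ∈ freeDeg 𝒜 GenIdx.degree n :=
    fun n f hf => genMap_mem 𝒜 (smul_mem_freeDeg 𝒜 _) hv hf
  -- relations between relations
  have hL := hG.ker_le hF (genMap k (A := A) v) hvdeg
  obtain ⟨w, hw, hwspan⟩ := exists_generators
    (fun j => LinearMap.ker (genMap k (A := A) v) ⊓ freeDeg 𝒜 GenIdx.degree j)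
    p₁ (max r (max q p₂))
    (fun j => finrank k (freeDeg 𝒜 (GenIdx.degree : GenOne 𝒜 m p₁ p₂ q → ℤ) j))
    (fun n hn => by simp [freeDeg_of_lt 𝒜 fun i => hn.trans_le (GenIdx.le_degree i)])
    (fun j => Submodule.finiteDimensional_inf_right _ _)
    (fun j => Submodule.finrank_mono inf_le_right)
  have hwmap := hG.inf_le_map_genMap 𝒜 (smul_mem_freeDeg 𝒜 _) _ hL p₁ (max r (max q p₂))
    (fun n hn => by simp [freeDeg_of_lt 𝒜 fun i => hn.trans_le (GenIdx.le_degree i)])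
    GenIdx.degree w hwspan
    fun n hn y hy => M.mem_span_smul_of_maxDeg_two hconn hx hsurj hv hex h2
      ((le_max_left _ _).trans_lt hn)
      (fun i => (i.degree_le.trans (le_max_right _ _)).trans_lt hn) hy.1 hy.2
  have hvw : ∀ a, genMap k (A := A) v (genMap k (A := A) w a) = 0 := fun a => by
    rw [genMap_apply (k := k) w, map_sum]
    exact Finset.sum_eq_zero fun r _ => by
      rw [genMap_smul, LinearMap.mem_ker.1 (hw r).1, smul_zero]
  replace hw := fun i => (hw i).2
  refine ⟨fun i r => v r i, (mem_matDeg 𝒜).2 fun i r => (mem_freeDeg 𝒜).1 (hv r) i,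
    fun i r => w r i, (mem_matDeg 𝒜).2 fun i r => (mem_freeDeg 𝒜).1 (hw r) i, ?_⟩
  rw [matMap_eq_genMap, matMap_eq_genMap]
  refine ⟨fun n => ?_, hvw, fun n => le_antisymm ?_ ?_⟩
  · rw [← Submodule.finrank_map_add_finrank_inf_ker (genMap k (A := A) x)
      (freeDeg 𝒜 GenIdx.degree n)]
    have e1 : (freeDeg 𝒜 GenIdx.degree n).map (genMap k (A := A) x) = M.deg n := by
      refine le_antisymm (Submodule.map_le_iff_le_comap.2 (hxdeg n)) ?_
      simpa using hxmap n
    have e2 : (freeDeg 𝒜 GenIdx.degree n).map (genMap k (A := A) v) =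
        freeDeg 𝒜 GenIdx.degree n ⊓ LinearMap.ker (genMap k (A := A) x) := by
      refine le_antisymm ?_ (inf_comm (LinearMap.ker (genMap k (A := A) x)) _ ▸ hvmap n)
      rintro _ ⟨a, ha, rfl⟩
      exact ⟨hvdeg n a ha, hxv a⟩
    rw [e1, e2]
  · rintro _ ⟨a, ha, rfl⟩
    exact ⟨genMap_mem 𝒜 (smul_mem_freeDeg 𝒜 _) hw ha, hvw a⟩
  · exact inf_comm (LinearMap.ker (genMap k (A := A) v)) _ ▸ hwmap n

-- The parameter space consists of pairs of homogeneous matrices, restricted to those with zero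
-- composite. The Hilbert series is a function of the ranks of the first matrix alone, so finitely
-- many rank functions give finitely many series.
variable (𝒜) in
theorem finite_hilbertSeries_of_hasResolution [∀ n, FiniteDimensional k (𝒜 n)] {ι ρ σ : Type*}
    [Finite ι] [Fintype ρ] [Fintype σ] (d : ι → ℤ) (e : ρ → ℤ) (f : σ → ℤ) :
    (hilbertSeries '' {M : GradedRightModule 𝒜 | M.HasResolution d e f}).Finite := by
  have hfin := finite_ranks_of_exact (k := k) (E := matDeg 𝒜 d e × matDeg 𝒜 e f)
    (matMap k ι ρ ∘ₗ (matDeg 𝒜 d e).subtype ∘ₗ LinearMap.fst k _ _)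
    (matMap k ρ σ ∘ₗ (matDeg 𝒜 e f).subtype ∘ₗ LinearMap.snd k _ _)
    (freeDeg 𝒜 e) (freeDeg 𝒜 f)
    {z | ∀ b, matMap k ι ρ z.1.1 (matMap k ρ σ z.2.1 b) = 0} (by
      rintro ⟨u, l⟩ hz n _ ⟨b, hb, rfl⟩
      exact ⟨matMap_mem 𝒜 l.2 hb, hz b⟩)
  refine (hfin.image fun h n => finrank k (freeDeg 𝒜 d n) - h n).subset ?_
  rintro _ ⟨M, ⟨u, hu, l, hl, hdim, hul, hexact⟩, rfl⟩
  refine ⟨_, ⟨(⟨u, hu⟩, ⟨l, hl⟩), ⟨hul, hexact⟩, rfl⟩, ?_⟩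
  funext n
  exact Nat.sub_eq_of_eq_add (hdim n).symm

end GradedRightModule

theorem corollary2p5 {k : Type*} [Field k] {A : Type*} [Ring A] [Algebra k A]
    (𝒜 : ℕ → Submodule k A) [GradedAlgebra 𝒜]
    (hconn : IsConnectedGraded 𝒜) (hfp : IsFinitelyPresentedAlgebra k A)
    (m p₁ p₂ q r : ℤ) :
    (∀ M ∈ GradedRightModule.boundedModules 𝒜 m p₁ p₂ q r, M.IsLocallyFinite) ∧
    (GradedRightModule.hilbertSeries ''
      GradedRightModule.boundedModules 𝒜 m p₁ p₂ q r).Finite := by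
  have := finiteDimensional_component 𝒜 hconn hfp
  exact ⟨fun M hM j => (M.finrank_deg_le hM.2.1 hM.2.2.1 j).1,
    (GradedRightModule.finite_hilbertSeries_of_hasResolution 𝒜 _ _ _).subset
      (Set.image_mono fun M hM => M.hasResolution_of_mem_boundedModules hconn hM)⟩
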